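/- **Proposition.** Let $i,j\ge 1$ and $k\ge 0$ be integers and let $F$ be a field. *The combinatorial figure.* Let $W$ be the Coxeter group of the simply laced graph with nodes $r_0,\dots,r_k,s_1,\dots,s_j,t_1,\dots,t_i$ consisting of three legs $r_0-r_1-\cdots-r_k$, $r_0-s_1-\cdots-s_j$ and $r_0-t_1-\cdots-t_i$ joined at $r_0$. The combinatorial $k_{i,j}$-figure (Gosset–Elte polytope or tessellation) has as vertices the cosets of the parabolic subgroup generated by all generators except $r_k$. Write $v_0$ for the base vertex. The edges are the pairs $\{wv_0,\,wr_kv_0\}$, $w\in W$. The $k_{1,1}$-facets, which are cross-polytopes, have vertex sets $\{wuv_0 : u\in\langle r_0,\dots,r_k,s_1,t_1\rangle\}$, $w\in W$; two distinct vertices of such a facet are opposing if no edge joins them. The group $W$ acts on the figure by combinatorial symmetries. *The compound simplex.* Consider two arrays of parameters, $(y_a)_{0\le a\le k}$ and $(y_{mn})_{0\le m\le i,\,0\le n\le j}$. Two different entries are joined if they belong to distinct arrays, or both to the first array, or both to a common row or a common column of the second array. Associate with the entries the vertices $V(y_k)=v_0$, $V(y_{a-1})=r_aV(y_a)$ for $1\le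 a\le k$, $V(y_{00})=r_0V(y_0)$ and $V(y_{mn})=s_n\cdots s_1t_m\cdots t_1V(y_{00})$. *The actions.* In the field $F(y)$ of rational functions in the entries let $t_m$ exchange $y_{(m-1)n}\leftrightarrow y_{mn}$ for all $n$, let $s_n$ exchange $y_{m(n-1)}\leftrightarrow y_{mn}$ for all $m$, let $r_n$ ($n\ge1$) exchange $y_{n-1}\leftrightarrow y_n$, and let $r_0$ exchange $y_0\leftrightarrow y_{00}$ and replace $y_{mn}$ by $\bar y_{mn}$ for $m,n\ge1$, where $$\frac{(y_0-y_{m0})(y_{0n}-y_{mn})(y_{00}-\bar y_{mn})}{(y_0-y_{mn})(y_{00}-y_{m0})(y_{0n}-\bar y_{mn})}=1;$$ all other entries are fixed. *Figures in a conic.* Let $L$ be an extension field of $F$ and let $C\subset\mathbb P^2(L)$ be a non-degenerate conic with a rational parametrisation $x\mapsto\gamma(x)$ (the image of $x\mapsto(x^2:x:1)$ under a projective transformation). A $k_{i,j}$-figure inscribed in $C$ is an injective map $\varphi$ from the vertices to the points of $C$ such that, among the points $\varphi(v)$ and the lines joining $\varphi(u),\varphi(v)$ for the edges $\{u,v\}$,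 the incidences are exactly the vertex–edge incidences. A $k_{1,1}$-facet has a centre if the lines joining the images of its pairs of opposing vertices (its axes) are all concurrent. Then the following hold. 1. $V$ is injective, and two entries are joined if and only if the corresponding vertices are joined by an edge of the $k_{i,j}$-figure. 2. The actions above extend to $F$-automorphisms of $F(y)$ and define a homomorphism $\rho$ from $W$ to the group of these automorphisms, the generators of $W$ being sent to the actions of the same name. 3. There is a countable set of non-zero polynomials over $F$ in the entries, finite if $W$ is finite, such that for every extension field $L$ of $F$, all generic values $y$ of the entries in $L$ (those at which none of these polynomials vanishes) and every parameterised conic $C$ as above: (a) there is exactly one $k_{i,j}$-figure $\varphi$ inscribed in $C$ for which every $k_{1,1}$-facet has a centre and $\varphi(V(e))=\gamma(y_e)$ for every entry $e$; thus the compound simplex with parameters $y$ is a determining sub-figure; (b) for every $w\in W$ and every entry $e$, the rational function $\rho(w)(y_e)$ is regular at $y$, and its value there is the parameter of the point $\varphi(wV(e))$; that is, the birational actions give the image of the compound simplex under the combinatorial symmetries $w\in W$. -/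

import Mathlib

namespace GossetElte

/-! ### The Coxeter group and the combinatorial figure of Coxeter symbol `k_{i,j}` -/

/-- Nodes of the Coxeter graph: the branch node `r 0` carries the three legs
`r 1, …, r k`, `s_1, …, s_j` and `t_1, …, t_i`. The indices of `s` and `t` are shifted by one:
`s ⟨n, _⟩` is the generator `s_{n+1}` and `t ⟨m, _⟩` is the generator `t_{m+1}`. -/
inductive Node (i j k : ℕ) : Type
  | r (n : Fin (k + 1)) : Node i j k
  | s (n : Fin j) : Node i j k
  | t (m : Fin i) : Node i j k

/-- Two nodes are linked in the Coxeter graph. -/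
def Node.Linked {i j k : ℕ} : Node i j k → Node i j k → Prop
  | .r a, .r b => a.val + 1 = b.val ∨ b.val + 1 = a.val
  | .s a, .s b => a.val + 1 = b.val ∨ b.val + 1 = a.val
  | .t a, .t b => a.val + 1 = b.val ∨ b.val + 1 = a.val
  | .r a, .s b => a.val = 0 ∧ b.val = 0
  | .s b, .r a => a.val = 0 ∧ b.val = 0
  | .r a, .t b => a.val = 0 ∧ b.val = 0
  | .t b, .r a => a.val = 0 ∧ b.val = 0
  | .s _, .t _ => False
  | .t _, .s _ => False

theorem Node.Linked.symm {i j k : ℕ} {a b : Node i j k} (h : a.Linked b) : b.Linked a := by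
  cases a <;> cases b <;> simp only [Node.Linked] at h ⊢ <;> tauto

open Classical in
/-- The Coxeter matrix of the graph: `3` for linked nodes, `2` for distinct nodes not linked. -/
noncomputable def coxeterMatrix (i j k : ℕ) : CoxeterMatrix (Node i j k) where
  M := Matrix.of fun a b => if a = b then 1 else if a.Linked b then 3 else 2
  isSymm := by
    refine Matrix.IsSymm.ext fun a b => ?_
    have hl : b.Linked a ↔ a.Linked b := ⟨Node.Linked.symm, Node.Linked.symm⟩
    simp only [Matrix.of_apply, hl, eq_comm]
  diagonal a := by simp
  off_diagonal a b h := by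
    simp only [Matrix.of_apply, if_neg h]
    split_ifs <;> decide

/-- The Coxeter group of the graph. -/
abbrev W (i j k : ℕ) : Type := (coxeterMatrix i j k).Group

/-- The Coxeter generator at a node. -/
noncomputable def gen {i j k : ℕ} (a : Node i j k) : W i j k := (coxeterMatrix i j k).simple a

/-- The parabolic subgroup omitting the ringed node `r k`: the stabiliser of a vertex. -/
noncomputable def vertexGroup (i j k : ℕ) : Subgroup (W i j k) :=
  Subgroup.closure (gen '' {a | a ≠ Node.r (Fin.last k)})

/-- Vertices of the combinatorial `k_{i,j}`-figure (Wythoff's construction with the end node `r k`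
of the first leg ringed): the cosets of the vertex group, on which `W i j k` acts. -/
abbrev Vertex (i j k : ℕ) : Type := W i j k ⧸ vertexGroup i j k

/-- The base vertex. -/
noncomputable def base (i j k : ℕ) : Vertex i j k := ((1 : W i j k) : W i j k ⧸ vertexGroup i j k)

/-- Two vertices are joined by an edge: edges are the images, under the group, of the edge that
joins the base vertex to its reflection in the ringed node. -/
def Adj {i j k : ℕ} (u v : Vertex i j k) : Prop :=
  ∃ w : W i j k, u = w • base i j k ∧ v = (w * gen (Node.r (Fin.last k))) • base i j k

/-- The nodes `r 0, …, r k, s_1, t_1`, which span the Coxeter graph of the symbol `k_{1,1}`. -/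
def Node.IsCross {i j k : ℕ} : Node i j k → Prop
  | .r _ => True
  | .s n => n.val = 0
  | .t m => m.val = 0

/-- The parabolic subgroup of the symbol `k_{1,1}`. -/
noncomputable def crossGroup (i j k : ℕ) : Subgroup (W i j k) :=
  Subgroup.closure (gen '' {a | Node.IsCross a})

/-- The vertex set of the `k_{1,1}`-facet (a cross-polytope) given by a group element. -/
def crossFacet {i j k : ℕ} (w : W i j k) : Set (Vertex i j k) :=
  {v | ∃ u ∈ crossGroup i j k, v = (w * u : W i j k) • base i j k}

/-- Opposing vertices of a `k_{1,1}`-facet: distinct vertices that no edge joins. -/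
def Opposing {i j k : ℕ} (w : W i j k) (u v : Vertex i j k) : Prop :=
  u ∈ crossFacet w ∧ v ∈ crossFacet w ∧ u ≠ v ∧ ¬ Adj u v

/-! ### The two arrays, the compound simplex and its place in the figure -/

/-- Positions in the two arrays: `Sum.inl a` is the position of `y_a`, and `Sum.inr (m, n)` is the
position of `y_{mn}` (column `m`, row `n`). -/
abbrev Entry (i j k : ℕ) : Type := Fin (k + 1) ⊕ (Fin (i + 1) × Fin (j + 1))

/-- The pairs of points that are joined in the compound simplex. -/
def SimplexAdj {i j k : ℕ} : Entry i j k → Entry i j k → Prop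
  | .inl a, .inl b => a ≠ b
  | .inl _, .inr _ => True
  | .inr _, .inl _ => True
  | .inr p, .inr q => p ≠ q ∧ (p.1 = q.1 ∨ p.2 = q.2)

/-- The element `r_{k-d+1} ⋯ r_{k-1} r_k`. -/
noncomputable def rWord (i j k : ℕ) : (d : ℕ) → d ≤ k → W i j k
  | 0, _ => 1
  | d + 1, h => gen (Node.r ⟨k - d, by omega⟩) * rWord i j k d (by omega)

/-- The element `s_n ⋯ s_2 s_1`. -/
noncomputable def sWord (i j k : ℕ) : (n : ℕ) → n ≤ j → W i j k
  | 0, _ => 1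
  | n + 1, h => gen (Node.s ⟨n, h⟩) * sWord i j k n (by omega)

/-- The element `t_m ⋯ t_2 t_1`. -/
noncomputable def tWord (i j k : ℕ) : (m : ℕ) → m ≤ i → W i j k
  | 0, _ => 1
  | m + 1, h => gen (Node.t ⟨m, h⟩) * tWord i j k m (by omega)

/-- The vertex that corresponds to an array entry: `y_k` is the base vertex,
`y_a = r_{a+1} ⋯ r_k y_k`, `y_{00} = r_0 y_0` and `y_{mn} = s_n ⋯ s_1 t_m ⋯ t_1 y_{00}`. -/
noncomputable def vert {i j k : ℕ} : Entry i j k → Vertex i j k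
  | .inl a => rWord i j k (k - a.val) (by omega) • base i j k
  | .inr p => (sWord i j k p.2.val (by omega) * tWord i j k p.1.val (by omega) *
      gen (Node.r 0) * rWord i j k k le_rfl) • base i j k

/-! ### The birational actions -/

/-- The six-point multi-ratio of `{y0, z}`, `{y0n, ym0}`, `{y00, ymn}`. -/
def multiRatio {K : Type*} [Field K] (y0 z y0n ym0 y00 ymn : K) : K :=
  ((y0 - ym0) * (y0n - ymn) * (y00 - z)) / ((y0 - ymn) * (y00 - ym0) * (y0n - z))

/-- The solution `z` of the six-point multi-ratio equation, see `multiRatio_eq_one_iff`. -/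
def multiRatioSol {K : Type*} [Field K] (y0 y0n ym0 y00 ymn : K) : K :=
  ((y0 - ym0) * (y0n - ymn) * y00 - (y0 - ymn) * (y00 - ym0) * y0n) /
    ((y0 - ym0) * (y0n - ymn) - (y0 - ymn) * (y00 - ym0))

theorem multiRatio_eq_one_iff {K : Type*} [Field K] (y0 z y0n ym0 y00 ymn : K)
    (h1 : y0 ≠ ym0) (h2 : y0n ≠ ymn) (h3 : y0 ≠ ymn) (h4 : y00 ≠ ym0) (h5 : y00 ≠ y0n)
    (h6 : (y0 - ym0) * (y0n - ymn) - (y0 - ymn) * (y00 - ym0) ≠ 0) :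
    multiRatio y0 z y0n ym0 y00 ymn = 1 ↔ z = multiRatioSol y0 y0n ym0 y00 ymn := by
  have a1 := sub_ne_zero.mpr h1
  have a2 := sub_ne_zero.mpr h2
  have a3 := sub_ne_zero.mpr h3
  have a4 := sub_ne_zero.mpr h4
  have a5 := sub_ne_zero.mpr h5
  unfold multiRatio multiRatioSol
  rw [eq_div_iff h6]
  constructor
  · intro h
    have hd : (y0 - ymn) * (y00 - ym0) * (y0n - z) ≠ 0 := by
      intro h0
      rw [h0, div_zero] at h
      exact zero_ne_one h
    rw [div_eq_one_iff_eq hd] at h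
    linear_combination -h
  · intro h
    have hz : y0n - z ≠ 0 := by
      intro h0
      have hzz : z = y0n := (sub_eq_zero.mp h0).symm
      subst hzz
      have : (y0 - ym0) * (z - ymn) * (y00 - z) = 0 := by linear_combination -h
      exact mul_ne_zero (mul_ne_zero a1 a2) a5 this
    rw [div_eq_one_iff_eq (mul_ne_zero (mul_ne_zero a3 a4) hz)]
    linear_combination -h

/-- The transposition of two consecutive indices `n` and `n + 1`. -/
def adjSwap {N : ℕ} (n : Fin N) : Equiv.Perm (Fin (N + 1)) := Equiv.swap n.castSucc n.succ

/-- The actions on arrays of elements of a field. The generators `r_n` (`n ≥ 1`), `s_n`, `t_m` swap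
consecutive entries of the first array, rows and columns of the second array; `r_0` swaps `y_0`
with `y_{00}`, and replaces `y_{mn}` (`m, n ≥ 1`) by the solution of the multi-ratio equation. -/
def act {i j k : ℕ} {K : Type*} [Field K] : Node i j k → (Entry i j k → K) → (Entry i j k → K)
  | .r ⟨n + 1, h⟩, y, .inl a => y (.inl (adjSwap ⟨n, by omega⟩ a))
  | .r ⟨_ + 1, _⟩, y, .inr p => y (.inr p)
  | .s _, y, .inl a => y (.inl a)
  | .s n, y, .inr p => y (.inr (p.1, adjSwap n p.2))
  | .t _, y, .inl a => y (.inl a)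
  | .t m, y, .inr p => y (.inr (adjSwap m p.1, p.2))
  | .r ⟨0, _⟩, y, .inl a => if a = 0 then y (.inr (0, 0)) else y (.inl a)
  | .r ⟨0, _⟩, y, .inr p =>
      if p = (0, 0) then y (.inl 0)
      else if p.1 = 0 ∨ p.2 = 0 then y (.inr p)
      else multiRatioSol (y (.inl 0)) (y (.inr (0, p.2))) (y (.inr (p.1, 0))) (y (.inr (0, 0)))
        (y (.inr p))

/-- The field `F(y)` of rational functions in the array entries. -/
abbrev RatField (i j k : ℕ) (F : Type*) [Field F] : Type _ :=
  FractionRing (MvPolynomial (Entry i j k) F)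

/-- The array of indeterminates. -/
noncomputable def indet (i j k : ℕ) (F : Type*) [Field F] (a : Entry i j k) : RatField i j k F :=
  algebraMap (MvPolynomial (Entry i j k) F) (RatField i j k F) (MvPolynomial.X a)

/-- The rational function `f` is regular at the point `y`, with value `z` there. -/
def HasValueAt {i j k : ℕ} {F L : Type*} [Field F] [Field L] [Algebra F L]
    (f : RatField i j k F) (y : Entry i j k → L) (z : L) : Prop :=
  ∃ p q : MvPolynomial (Entry i j k) F, MvPolynomial.aeval y q ≠ 0 ∧
    f * algebraMap _ (RatField i j k F) q = algebraMap _ (RatField i j k F) p ∧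
    z = MvPolynomial.aeval y p / MvPolynomial.aeval y q

/-! ### Figures inscribed in a conic of the projective plane -/

/-- The projective plane over a field. -/
abbrev Plane (L : Type*) [Field L] : Type _ := Projectivization L (Fin 3 → L)

/-- The point `x` lies on the line `p + q` determined by two distinct points `p`, `q`. -/
def OnLine {L : Type*} [Field L] (x p q : Plane L) : Prop :=
  x.submodule ≤ p.submodule ⊔ q.submodule

/-- A rationally parameterised (non-degenerate) conic: the image under a projective transformation
`M` of the conic `X Z = Y ^ 2`. -/
def conic {L : Type*} [Field L] (M : GL (Fin 3) L) : Set (Plane L) :=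
  {p | ∃ (v : Fin 3 → L) (hv : M.val.mulVec v ≠ 0), v 0 * v 2 = v 1 ^ 2 ∧
    p = Projectivization.mk L (M.val.mulVec v) hv}

theorem conicVec_ne_zero {L : Type*} [Field L] (M : GL (Fin 3) L) (x : L) :
    M.val.mulVec ![x ^ 2, x, 1] ≠ 0 := by
  intro h
  have h2 : (M⁻¹).val.mulVec (M.val.mulVec ![x ^ 2, x, 1]) = 0 := by rw [h, Matrix.mulVec_zero]
  rw [Matrix.mulVec_mulVec, Units.inv_mul, Matrix.one_mulVec] at h2
  simpa using congrFun h2 2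

/-- The point of the conic with parameter `x`. -/
def conicPoint {L : Type*} [Field L] (M : GL (Fin 3) L) (x : L) : Plane L :=
  Projectivization.mk L (M.val.mulVec ![x ^ 2, x, 1]) (conicVec_ne_zero M x)

theorem conicPoint_mem_conic {L : Type*} [Field L] (M : GL (Fin 3) L) (x : L) :
    conicPoint M x ∈ conic M :=
  ⟨![x ^ 2, x, 1], conicVec_ne_zero M x, by simp, rfl⟩

/-- A combinatorial `k_{i,j}`-polytope or tessellation in the plane, inscribed in a conic:
the vertices are distinct points of the conic, and among the points and the lines that join the
ends of edges, the incidences are exactly the vertex-edge incidences. -/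
structure IsInscribed {i j k : ℕ} {L : Type*} [Field L] (M : GL (Fin 3) L)
    (φ : Vertex i j k → Plane L) : Prop where
  mem_conic : ∀ v, φ v ∈ conic M
  injective : Function.Injective φ
  incidence : ∀ u v x, Adj u v → (OnLine (φ x) (φ u) (φ v) ↔ x = u ∨ x = v)

/-- Every `k_{1,1}`-facet has a centre: the lines that join its opposing vertices are concurrent. -/
def HasCentres {i j k : ℕ} {L : Type*} [Field L] (φ : Vertex i j k → Plane L) : Prop :=
  ∀ w : W i j k, ∃ c : Plane L, ∀ u v : Vertex i j k, Opposing w u v → OnLine c (φ u) (φ v)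

end GossetElte

namespace GossetElte

/-! ### Simply laced reflection representations -/

section SimplyLaced

variable {B : Type*}

/-! The combinatorics is linearised. `W` acts by reflections on an integral lattice in which the
entries become vectors of norm 1 (`latVec`). The vector of `y_k` is dominant and orthogonal to every
simple root except that of the ringed node, so its stabiliser is the vertex group
(`mem_vertexGroup_iff`, from the general statement `mem_closure_of_rep_eq`) and vertices embed in
the lattice as its orbit. Norms then decide adjacency: differences along edges have norm 2, while
opposing vertices of a cross-polytope have a fixed sum and differ by a vector of norm 4.

The Coxeter relations between the birational actions are rational identities, valid wherever the
denominators are non-zero. To see that no denominator vanishes identically, the indeterminates are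
specialised to the monomials of their lattice vectors. There `y_00 y_mn = y_m0 y_0n`, and the
multi-ratio equation gives `y_m0 y_0n / y_0`, which is the monomial of the reflected vector
(`act_monoPoint`). Hence along every word the arrays specialise to monomials of the linear action,
with non-zero denominators (`actRegular_monoPoint`), and the actions define the homomorphism
`birational`. It assigns a rational function to each vertex (`vertexFun`), and distinct vertices
receive distinct functions because their monomials differ (`vertexFun_injective`). Generic values
are those avoiding the chosen denominators of these functions and the numerators of their
differences.

Geometrically, the chords of a conic joining three pairs of parameters are concurrent when the pairs
belong to one involution, a condition equivalent to the multi-ratio equation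
(`axisDet_multiRatioSol`). Transporting that equation by field automorphisms gives a centre to every
facet (`hasCentres_vertexVal`). Conversely two axes fix the centre, and the centre with one end of a
third axis fixes the other end (`eq_conicPoint_of_centre`). Induction on words therefore places
every vertex, which is uniqueness (`eq_vertexVal_of_hasCentres`). -/

/-- Vectors in an additive group with an integral symmetric form whose Gram matrix is the one
prescribed by a simply laced Coxeter matrix. -/
structure SimplyLacedRoots (M : CoxeterMatrix B) (X : Type*) [AddCommGroup X] where
  form : X →+ X →+ ℤ
  root : B → X
  symm : ∀ x y, form x y = form y x
  root_self : ∀ b, form (root b) (root b) = 2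
  root_pair : ∀ b c, b ≠ c →
    (M b c = 2 ∧ form (root b) (root c) = 0) ∨ (M b c = 3 ∧ form (root b) (root c) = -1)

namespace SimplyLacedRoots

variable {M : CoxeterMatrix B} {X : Type*} [AddCommGroup X] (R : SimplyLacedRoots M X)

/-- The reflection in a simple root. -/
def reflect (b : B) : AddMonoid.End X where
  toFun x := x - R.form x (R.root b) • R.root b
  map_zero' := by simp
  map_add' x y := by simp only [map_add, AddMonoidHom.add_apply, add_smul]; abel

theorem reflect_apply (b : B) (x : X) : R.reflect b x = x - R.form x (R.root b) • R.root b := rfl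

theorem reflect_reflect (b : B) (x : X) : R.reflect b (R.reflect b x) = x := by
  simp only [reflect_apply, map_sub, map_zsmul, R.root_self]
  module

theorem end_mul_apply (f g : AddMonoid.End X) (x : X) : (f * g) x = f (g x) := rfl

/-- The product of two reflections moves a vector only inside the span of the two roots, so each
relation is a finite computation with the Gram matrix. -/
theorem isLiftable : M.IsLiftable R.reflect := by
  intro b c
  by_cases hbc : b = c
  · subst hbc
    rw [M.diagonal, pow_one]
    ext x
    exact R.reflect_reflect b x
  · have hcb := R.symm (R.root c) (R.root b)
    rcases R.root_pair b c hbc with ⟨hM, hf⟩ | ⟨hM, hf⟩ <;> rw [hM] <;> ext x <;>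
    · rw [hf] at hcb
      simp only [pow_succ, pow_zero, one_mul, end_mul_apply, reflect_apply, map_sub, map_zsmul,
        R.root_self, hf, hcb]
      change _ = x
      module

/-- The reflection representation of the Coxeter group. -/
noncomputable def rep : M.Group →* AddMonoid.End X := M.toCoxeterSystem.lift ⟨_, R.isLiftable⟩

@[simp]
theorem rep_simple (b : B) : R.rep (M.simple b) = R.reflect b := by
  have := M.toCoxeterSystem.lift_apply_simple R.isLiftable b
  rwa [M.toCoxeterSystem_simple] at this

theorem rep_mul_apply (v w : M.Group) (x : X) : R.rep (v * w) x = R.rep v (R.rep w x) := by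
  rw [map_mul]; rfl

@[simp]
theorem rep_one_apply (x : X) : R.rep 1 x = x := by rw [map_one]; rfl

theorem rep_inv_rep (w : M.Group) (x : X) : R.rep w⁻¹ (R.rep w x) = x := by
  rw [← rep_mul_apply, inv_mul_cancel, rep_one_apply]

theorem rep_injective (w : M.Group) : Function.Injective (R.rep w) := fun x y h => by
  rw [← R.rep_inv_rep w x, h, rep_inv_rep]

theorem form_rep_rep (w : M.Group) (x y : X) :
    R.form (R.rep w x) (R.rep w y) = R.form x y := by
  induction w using M.toCoxeterSystem.simple_induction_left generalizing x y with
  | one => simp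
  | mul_simple_left w b ih =>
    rw [M.toCoxeterSystem_simple, rep_mul_apply, rep_mul_apply, rep_simple]
    simp only [reflect_apply, map_sub, AddMonoidHom.sub_apply, map_zsmul,
        AddMonoidHom.zsmul_apply, R.root_self, smul_eq_mul, ih, R.symm (R.root b)]
    ring

/-- The cone of nonnegative combinations of simple roots. -/
def positive : AddSubmonoid X := AddSubmonoid.closure (Set.range R.root)

theorem root_mem_positive (b : B) : R.root b ∈ R.positive :=
  AddSubmonoid.subset_closure ⟨b, rfl⟩

local prefix:100 "ℓ" => M.toCoxeterSystem.length

/-- An element that does not have a simple reflection as a right descent maps the simple root to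
a positive root. -/
theorem rep_root_mem_positive (w : M.Group) (b : B) (h : ℓ w < ℓ (w * M.simple b)) :
    R.rep w (R.root b) ∈ R.positive := by
  induction hn : ℓ w using Nat.strong_induction_on generalizing w b with
  | _ n ih =>
  subst hn
  have lm : ∀ (v : M.Group) (a : B),
      ℓ (v * M.simple a) = ℓ v + 1 ∨ ℓ (v * M.simple a) + 1 = ℓ v := fun v a => by
    have := M.toCoxeterSystem.length_mul_simple v a
    rwa [M.toCoxeterSystem_simple] at this
  have ss : ∀ a : B, M.simple a * M.simple a = 1 := fun a => by
    have := M.toCoxeterSystem.simple_mul_simple_self a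
    rwa [M.toCoxeterSystem_simple] at this
  by_cases hw : w = 1
  · subst hw
    simpa using R.root_mem_positive b
  obtain ⟨a, ha⟩ := M.toCoxeterSystem.exists_rightDescent_of_ne_one hw
  rw [CoxeterSystem.IsRightDescent, M.toCoxeterSystem_simple] at ha
  have hab : a ≠ b := by
    rintro rfl
    omega
  obtain ⟨v, rfl⟩ : ∃ v, w = v * M.simple a := ⟨w * M.simple a, by rw [mul_assoc, ss, mul_one]⟩
  rw [mul_assoc, ss, mul_one] at ha
  have pw := M.toCoxeterSystem.simple_mul_simple_pow a b
  rw [M.toCoxeterSystem_simple] at pw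
  rcases R.root_pair a b hab with ⟨hM, hf⟩ | ⟨hM, hf⟩
  -- Commuting case: `s_a` fixes the root of `b`, so the shorter `v` has the same image of it, and
  -- `b` is still an ascent of `v`.
  · have hc : M.simple a * M.simple b = M.simple b * M.simple a := by
      rw [hM] at pw
      have := congrArg (fun x => x * (M.simple b * M.simple a)) pw
      simp only [pow_two, one_mul, mul_assoc] at this
      rwa [← mul_assoc (M.simple b) (M.simple b), ss, one_mul, ss, mul_one] at this
    rw [rep_mul_apply, rep_simple, reflect_apply, R.symm, hf, zero_smul, sub_zero]
    refine ih _ ha _ _ ?_ rfl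
    rw [mul_assoc, hc, ← mul_assoc] at h
    rcases lm v b with h1 | h1
    · omega
    · have := lm (v * M.simple b) a
      omega
  -- Braid case: `s_a` sends the root of `b` to the sum of both roots. Either both are positive
  -- under `v`, or `b` is a descent of `v` and the sum is the image under `s_b` of the root of `a`,
  -- to which the shorter `v s_b` applies.
  · have hc : M.simple a * (M.simple b * M.simple a) = M.simple b * (M.simple a * M.simple b) := by
      rw [hM] at pw
      have := congrArg (fun x => x * (M.simple b * (M.simple a * M.simple b))) pw
      simp only [pow_succ, pow_zero, one_mul, mul_assoc] at this
      rw [← mul_assoc (M.simple b) (M.simple b), ss, one_mul,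
        ← mul_assoc (M.simple a) (M.simple a), ss, one_mul, ss, mul_one] at this
      exact this
    have hst : R.reflect a (R.root b) = R.root a + R.root b := by
      rw [reflect_apply, R.symm, hf]; module
    rw [rep_mul_apply, rep_simple, hst]
    rcases lm v b with h1 | h1
    · rw [map_add]
      exact add_mem (ih _ ha _ _ ha rfl) (ih _ ha _ _ (by omega) rfl)
    · have h2 : R.rep v (R.root a + R.root b) = R.rep (v * M.simple b) (R.root a) := by
        rw [rep_mul_apply, rep_simple, reflect_apply, hf]
        congr 1
        module
      rw [h2]
      refine ih _ (by omega) _ _ ?_ rfl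
      rcases lm (v * M.simple b) a with h3 | h3
      · omega
      · have h4 := lm (v * M.simple b * M.simple a) b
        rw [mul_assoc, mul_assoc, ← hc, ← mul_assoc, ← mul_assoc] at h4
        have h5 := lm (v * M.simple a * M.simple b) a
        omega

theorem form_nonneg_of_mem_positive {x y : X} (hx : ∀ b, 0 ≤ R.form x (R.root b))
    (hy : y ∈ R.positive) : 0 ≤ R.form x y := by
  induction hy using AddSubmonoid.closure_induction with
  | mem _ h => obtain ⟨b, rfl⟩ := h; exact hx b
  | zero => simp
  | add _ _ _ _ h1 h2 => rw [map_add]; exact add_nonneg h1 h2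

/-- The stabiliser of a dominant vector is generated by simple reflections. -/
theorem mem_closure_of_rep_eq {x : X} (hx : ∀ b, 0 ≤ R.form x (R.root b)) (w : M.Group)
    (hw : R.rep w x = x) :
    w ∈ Subgroup.closure (M.simple '' {b | R.form x (R.root b) = 0}) := by
  induction hn : ℓ w using Nat.strong_induction_on generalizing w with
  | _ n ih =>
  subst hn
  by_cases h1 : w = 1
  · subst h1
    exact one_mem _
  have ss : ∀ a : B, M.simple a * M.simple a = 1 := fun a => by
    have := M.toCoxeterSystem.simple_mul_simple_self a
    rwa [M.toCoxeterSystem_simple] at this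
  obtain ⟨b, hb⟩ := M.toCoxeterSystem.exists_leftDescent_of_ne_one h1
  rw [CoxeterSystem.IsLeftDescent, M.toCoxeterSystem_simple] at hb
  obtain ⟨v, rfl⟩ : ∃ v, w = M.simple b * v := ⟨M.simple b * w, by rw [← mul_assoc, ss, one_mul]⟩
  rw [← mul_assoc, ss, one_mul] at hb
  have hinv : (M.simple b)⁻¹ = M.simple b := inv_eq_of_mul_eq_one_left (ss b)
  have hp : R.rep v⁻¹ (R.root b) ∈ R.positive := by
    refine R.rep_root_mem_positive _ _ ?_
    rw [← M.toCoxeterSystem.length_inv v, ← M.toCoxeterSystem.length_inv (M.simple b * v),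
      mul_inv_rev, hinv] at hb
    exact hb
  have hneg : R.rep v⁻¹ (R.reflect b (R.root b)) = - R.rep v⁻¹ (R.root b) := by
    rw [← map_neg, reflect_apply, R.root_self]
    congr 1
    module
  -- As `w` fixes `x`, the pairing of `x` with the root equals that with its image under `w⁻¹`,
  -- which is the negative of a positive vector. Dominance then makes both sides zero, so `s_b`
  -- fixes `x` and can be split off.
  have hform : R.form x (R.root b) = - R.form x (R.rep v⁻¹ (R.root b)) := by
    have := R.form_rep_rep (M.simple b * v)⁻¹ x (R.root b)
    rw [mul_inv_rev, hinv, rep_mul_apply _ _ _ (R.root b), rep_simple, hneg, map_neg] at this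
    have hx' : R.rep (v⁻¹ * M.simple b) x = x := by
      conv_lhs => rw [← hw, ← hinv, ← mul_inv_rev, hinv]
      rw [rep_inv_rep]
    rw [← this, hx']
  have h0 : R.form x (R.root b) = 0 := by
    have := R.form_nonneg_of_mem_positive hx hp
    have := hx b
    omega
  have hbx : R.reflect b x = x := by rw [reflect_apply, h0, zero_smul, sub_zero]
  refine mul_mem (Subgroup.subset_closure ⟨b, h0, rfl⟩) (ih _ hb v ?_ rfl)
  rw [rep_mul_apply, rep_simple] at hw
  rw [← R.reflect_reflect b (R.rep v x), hw, hbx]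

end SimplyLacedRoots

end SimplyLaced

variable {i j k : ℕ}

/-! ### The reflection representation of `W i j k` -/

/-- The lattice on which the reflection representation is defined. -/
abbrev Lat (i j k : ℕ) : Type := (Fin (k + 1) → ℤ) × (Fin (i + 1) → ℤ) × (Fin (j + 1) → ℤ)

/-- The invariant form. -/
def latForm (i j k : ℕ) : Lat i j k →+ Lat i j k →+ ℤ :=
  AddMonoidHom.mk' (fun x => AddMonoidHom.mk' (fun y =>
      x.1 ⬝ᵥ y.1 + x.2.1 ⬝ᵥ y.2.1 - (∑ m, x.2.1 m) * (∑ m, y.2.1 m) + x.2.2 ⬝ᵥ y.2.2)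
      (fun y z => by
        simp only [Prod.fst_add, Prod.snd_add, dotProduct_add, Pi.add_apply,
          Finset.sum_add_distrib]
        ring))
    (fun x y => by
      ext z
      simp only [AddMonoidHom.mk'_apply, AddMonoidHom.add_apply, Prod.fst_add, Prod.snd_add,
        add_dotProduct, Pi.add_apply, Finset.sum_add_distrib]
      ring)

theorem latForm_apply (x y : Lat i j k) : latForm i j k x y =
    x.1 ⬝ᵥ y.1 + x.2.1 ⬝ᵥ y.2.1 - (∑ m, x.2.1 m) * (∑ m, y.2.1 m) + x.2.2 ⬝ᵥ y.2.2 := rfl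

/-- The simple roots. -/
def latRoot : Node i j k → Lat i j k
  | .r ⟨0, _⟩ => (Pi.single 0 1, -Pi.single 0 1, -Pi.single 0 1)
  | .r ⟨n + 1, h⟩ => (Pi.single ⟨n + 1, h⟩ 1 - Pi.single ⟨n, by omega⟩ 1, 0, 0)
  | .s n => (0, 0, Pi.single n.castSucc 1 - Pi.single n.succ 1)
  | .t m => (0, Pi.single m.castSucc 1 - Pi.single m.succ 1, 0)

theorem latForm_root_r_zero (x : Lat i j k) (h : 0 < k + 1) :
    latForm i j k x (latRoot (.r ⟨0, h⟩)) = x.1 0 - x.2.1 0 + ∑ m, x.2.1 m - x.2.2 0 := by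
  simp [latForm_apply, latRoot]
  ring

theorem latForm_root_r_succ (x : Lat i j k) (n : ℕ) (h : n + 1 < k + 1) :
    latForm i j k x (latRoot (.r ⟨n + 1, h⟩)) = x.1 ⟨n + 1, h⟩ - x.1 ⟨n, by omega⟩ := by
  simp [latForm_apply, latRoot, dotProduct_sub]

theorem latForm_root_s (x : Lat i j k) (n : Fin j) :
    latForm i j k x (latRoot (.s n)) = x.2.2 n.castSucc - x.2.2 n.succ := by
  simp [latForm_apply, latRoot, dotProduct_sub]

theorem latForm_root_t (x : Lat i j k) (m : Fin i) :
    latForm i j k x (latRoot (.t m)) = x.2.1 m.castSucc - x.2.1 m.succ := by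
  simp [latForm_apply, latRoot, dotProduct_sub]

theorem latForm_symm (x y : Lat i j k) : latForm i j k x y = latForm i j k y x := by
  rw [latForm_apply, latForm_apply, dotProduct_comm x.1, dotProduct_comm x.2.1,
    dotProduct_comm x.2.2]
  ring

/-- The product of sums subtracted in the form matters only at the branch node: its root has three
entries `±1`, and the correction lowers its norm from 3 to 2. -/
theorem latForm_root_self (b : Node i j k) : latForm i j k (latRoot b) (latRoot b) = 2 := by
  rcases b with ⟨_ | n, h⟩ | n | m
  · rw [latForm_root_r_zero]
    simp [latRoot]
  · rw [latForm_root_r_succ]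
    simp [latRoot]
  · rw [latForm_root_s]
    simp [latRoot, Fin.ext_iff]
  · rw [latForm_root_t]
    simp [latRoot, Fin.ext_iff]

theorem sum_latRoot_t (m : Fin i) : ∑ a, (latRoot (.t m) : Lat i j k).2.1 a = 0 := by
  simp [latRoot]

open Classical in
theorem latForm_root_root (b c : Node i j k) (h : b ≠ c) :
    latForm i j k (latRoot b) (latRoot c) = if b.Linked c then -1 else 0 := by
  rcases b with ⟨_ | n, hn⟩ | n | n <;> rcases c with ⟨_ | m, hm⟩ | m | m
  all_goals
    first
    | rw [latForm_root_r_zero]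
    | rw [latForm_root_r_succ]
    | rw [latForm_root_s]
    | rw [latForm_root_t]
    try rw [sum_latRoot_t]
    simp [latRoot, Node.Linked, Pi.single_apply, Fin.ext_iff] at h ⊢
    try split_ifs <;> omega

/-- The roots of `W i j k`. -/
def latRoots (i j k : ℕ) : SimplyLacedRoots (coxeterMatrix i j k) (Lat i j k) where
  form := latForm i j k
  root := latRoot
  symm := latForm_symm
  root_self := latForm_root_self
  root_pair b c h := by
    rw [latForm_root_root b c h]
    simp only [coxeterMatrix, Matrix.of_apply, if_neg h]
    split_ifs <;> simp

/-- The reflection representation on the lattice. -/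
noncomputable def latRep (i j k : ℕ) : W i j k →* AddMonoid.End (Lat i j k) := (latRoots i j k).rep

theorem latRep_mul_apply (v w : W i j k) (x : Lat i j k) :
    latRep i j k (v * w) x = latRep i j k v (latRep i j k w x) :=
  (latRoots i j k).rep_mul_apply v w x

theorem latRep_injective (w : W i j k) : Function.Injective (latRep i j k w) :=
  (latRoots i j k).rep_injective w

theorem latRep_one_apply (x : Lat i j k) : latRep i j k 1 x = x := (latRoots i j k).rep_one_apply x

theorem latRep_gen (b : Node i j k) (x : Lat i j k) :
    latRep i j k (gen b) x = x - latForm i j k x (latRoot b) • latRoot b := by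
  rw [latRep, gen, SimplyLacedRoots.rep_simple]; rfl

theorem latForm_latRep (w : W i j k) (x y : Lat i j k) :
    latForm i j k (latRep i j k w x) (latRep i j k w y) = latForm i j k x y :=
  (latRoots i j k).form_rep_rep w x y

/-- Reflection in a difference of consecutive unit vectors, which is how all generators other than
`r 0` act. -/
theorem comp_swap_eq {N : ℕ} (n : Fin N) (x : Fin (N + 1) → ℤ) :
    x - (x n.castSucc - x n.succ) • (Pi.single n.castSucc 1 - Pi.single n.succ 1) =
      x ∘ adjSwap n := by
  have hne : n.castSucc ≠ n.succ := by simp [Fin.ext_iff]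
  ext a
  simp only [adjSwap, Pi.sub_apply, Pi.smul_apply, Function.comp_apply, smul_eq_mul]
  by_cases h1 : a = n.castSucc
  · subst h1
    simp [hne]
  · by_cases h2 : a = n.succ
    · subst h2
      simp [hne.symm]
    · simp [h1, h2, Equiv.swap_apply_of_ne_of_ne h1 h2]

theorem latRep_r_succ (x : Lat i j k) (n : ℕ) (h : n + 1 < k + 1) :
    latRep i j k (gen (.r ⟨n + 1, h⟩)) x = (x.1 ∘ adjSwap ⟨n, by omega⟩, x.2) := by
  rw [latRep_gen, latForm_root_r_succ, ← comp_swap_eq]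
  refine Prod.ext ?_ ?_
  -- On the first leg the roots carry the opposite sign, chosen to make the vector of `y_k`
  -- dominant. A reflection does not see the sign.
  · change x.1 - (x.1 ⟨n + 1, h⟩ - x.1 ⟨n, _⟩) • (Pi.single ⟨n + 1, h⟩ 1 - Pi.single ⟨n, _⟩ 1) =
      x.1 - (x.1 ⟨n, _⟩ - x.1 ⟨n + 1, h⟩) • (Pi.single ⟨n, _⟩ 1 - Pi.single ⟨n + 1, h⟩ 1)
    module
  · simp [latRoot]

theorem latRep_s (x : Lat i j k) (n : Fin j) :
    latRep i j k (gen (.s n)) x = (x.1, x.2.1, x.2.2 ∘ adjSwap n) := by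
  rw [latRep_gen, latForm_root_s, ← comp_swap_eq]
  simp [latRoot, Prod.ext_iff]

theorem latRep_t (x : Lat i j k) (m : Fin i) :
    latRep i j k (gen (.t m)) x = (x.1, x.2.1 ∘ adjSwap m, x.2.2) := by
  rw [latRep_gen, latForm_root_t, ← comp_swap_eq]
  simp [latRoot, Prod.ext_iff]

/-- The lattice vector of an array entry. -/
def latVec : Entry i j k → Lat i j k
  | .inl a => (Pi.single a 1, 0, 0)
  | .inr p => (0, Pi.single p.1 1, Pi.single p.2 1)

theorem latVec_injective : Function.Injective (latVec : Entry i j k → Lat i j k) := by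
  rintro (a | ⟨m, n⟩) (b | ⟨m', n'⟩) h
  · simp only [latVec, Prod.mk.injEq] at h
    have := congrFun h.1 a
    simp [Pi.single_apply] at this
    rw [this]
  · have := congrFun (congrArg (fun x => x.1) h) a
    simp [latVec] at this
  · have := congrFun (congrArg (fun x => x.1) h) b
    simp [latVec] at this
  · simp only [latVec, Prod.mk.injEq, true_and] at h
    have h1 := congrFun h.1 m
    have h2 := congrFun h.2 n
    simp [Pi.single_apply] at h1 h2
    rw [h1, h2]

theorem single_comp_perm {N : ℕ} (σ : Equiv.Perm (Fin N)) (hσ : ∀ a, σ (σ a) = a) (a : Fin N) :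
    (Pi.single a 1 : Fin N → ℤ) ∘ σ = Pi.single (σ a) 1 := by
  ext b
  simp only [Function.comp_apply, Pi.single_apply]
  refine if_congr ⟨fun h => ?_, fun h => ?_⟩ rfl rfl
  · rw [← h, hσ]
  · rw [h, hσ]

theorem adjSwap_adjSwap {N : ℕ} (n : Fin N) (a : Fin (N + 1)) : adjSwap n (adjSwap n a) = a :=
  Equiv.symm_apply_apply (adjSwap n) a

theorem latRep_r_succ_inl (n : ℕ) (h : n + 1 < k + 1) (a : Fin (k + 1)) :
    latRep i j k (gen (.r ⟨n + 1, h⟩)) (latVec (.inl a)) =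
      latVec (.inl (adjSwap ⟨n, by omega⟩ a)) := by
  rw [latRep_r_succ]
  simp only [latVec]
  rw [single_comp_perm _ (adjSwap_adjSwap _)]

theorem latRep_r_succ_inr (n : ℕ) (h : n + 1 < k + 1) (p : Fin (i + 1) × Fin (j + 1)) :
    latRep i j k (gen (.r ⟨n + 1, h⟩)) (latVec (.inr p)) = latVec (.inr p) := by
  rw [latRep_r_succ]
  rfl

theorem latRep_s_inl (n : Fin j) (a : Fin (k + 1)) :
    latRep i j k (gen (.s n)) (latVec (.inl a)) = latVec (.inl a) := by
  rw [latRep_s]; rfl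

theorem latRep_s_inr (n : Fin j) (p : Fin (i + 1) × Fin (j + 1)) :
    latRep i j k (gen (.s n)) (latVec (.inr p)) = latVec (.inr (p.1, adjSwap n p.2)) := by
  rw [latRep_s]
  simp only [latVec]
  rw [single_comp_perm _ (adjSwap_adjSwap _)]

theorem latRep_t_inl (m : Fin i) (a : Fin (k + 1)) :
    latRep i j k (gen (.t m)) (latVec (.inl a)) = latVec (.inl a) := by
  rw [latRep_t]; rfl

theorem latRep_t_inr (m : Fin i) (p : Fin (i + 1) × Fin (j + 1)) :
    latRep i j k (gen (.t m)) (latVec (.inr p)) = latVec (.inr (adjSwap m p.1, p.2)) := by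
  rw [latRep_t]
  simp only [latVec]
  rw [single_comp_perm _ (adjSwap_adjSwap _)]

theorem latForm_latVec_inl_r_zero (a : Fin (k + 1)) (h : 0 < k + 1) :
    latForm i j k (latVec (.inl a)) (latRoot (.r ⟨0, h⟩)) = if a = 0 then 1 else 0 := by
  rw [latForm_root_r_zero]
  simp [latVec, Pi.single_apply, eq_comm]

theorem latForm_latVec_inr_r_zero (p : Fin (i + 1) × Fin (j + 1)) (h : 0 < k + 1) :
    latForm i j k (latVec (.inr p)) (latRoot (.r ⟨0, h⟩)) =
      1 - (if p.1 = 0 then 1 else 0) - (if p.2 = 0 then 1 else 0) := by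
  rw [latForm_root_r_zero]
  simp [latVec, Pi.single_apply, eq_comm]
  ring

theorem latRep_r_zero_inl_zero :
    latRep i j k (gen (.r 0)) (latVec (.inl 0)) = latVec (.inr (0, 0)) := by
  change latRep i j k (gen (.r ⟨0, Nat.succ_pos k⟩)) _ = _
  rw [latRep_gen, latForm_latVec_inl_r_zero]
  simp [latVec, latRoot]

theorem latRep_r_zero_inl {a : Fin (k + 1)} (h : a ≠ 0) :
    latRep i j k (gen (.r 0)) (latVec (.inl a)) = latVec (.inl a) := by
  change latRep i j k (gen (.r ⟨0, Nat.succ_pos k⟩)) _ = _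
  rw [latRep_gen, latForm_latVec_inl_r_zero]
  simp [h]

theorem latRep_r_zero_inr_zero :
    latRep i j k (gen (.r 0)) (latVec (.inr (0, 0))) = latVec (.inl 0) := by
  change latRep i j k (gen (.r ⟨0, Nat.succ_pos k⟩)) _ = _
  rw [latRep_gen, latForm_latVec_inr_r_zero]
  simp [latVec, latRoot]
  rfl

theorem latRep_r_zero_inr {p : Fin (i + 1) × Fin (j + 1)} (h0 : p ≠ (0, 0))
    (h : p.1 = 0 ∨ p.2 = 0) :
    latRep i j k (gen (.r 0)) (latVec (.inr p)) = latVec (.inr p) := by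
  change latRep i j k (gen (.r ⟨0, Nat.succ_pos k⟩)) _ = _
  rw [latRep_gen, latForm_latVec_inr_r_zero]
  rw [ne_eq, Prod.ext_iff] at h0
  by_cases h1 : p.1 = 0 <;> by_cases h2 : p.2 = 0 <;> simp_all

/-- The only entries that leave the array under a generator. Read multiplicatively, this is the
monomial shadow of the multi-ratio formula. -/
theorem latRep_r_zero_inr_of_ne {m : Fin (i + 1)} {n : Fin (j + 1)} (hm : m ≠ 0) (hn : n ≠ 0) :
    latRep i j k (gen (.r 0)) (latVec (.inr (m, n))) =
      latVec (.inr (m, 0)) + latVec (.inr (0, n)) - latVec (.inl 0) := by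
  change latRep i j k (gen (.r ⟨0, Nat.succ_pos k⟩)) _ = _
  rw [latRep_gen, latForm_latVec_inr_r_zero]
  simp [latVec, latRoot, hm, hn]
  exact add_comm _ _

/-! ### Vertices as lattice vectors -/

-- The vector of `y_k` pairs with the simple roots like the fundamental weight of the ringed node.
open Classical in
theorem latForm_latVec_last (b : Node i j k) :
    latForm i j k (latVec (.inl (Fin.last k))) (latRoot b) =
      if b = .r (Fin.last k) then 1 else 0 := by
  rcases b with ⟨_ | n, h⟩ | n | m
  · rw [latForm_latVec_inl_r_zero]
    simp [Fin.ext_iff, eq_comm]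
  · rw [latForm_root_r_succ]
    have : n ≠ k := by omega
    simp [latVec, Pi.single_apply, Fin.ext_iff, this]
  · rw [latForm_root_s]
    simp [latVec]
  · rw [latForm_root_t]
    simp [latVec]

theorem latRep_last_of_mem {w : W i j k} (hw : w ∈ vertexGroup i j k) :
    latRep i j k w (latVec (.inl (Fin.last k))) = latVec (.inl (Fin.last k)) := by
  induction hw using Subgroup.closure_induction with
  | mem _ h =>
    obtain ⟨b, hb, rfl⟩ := h
    rw [latRep_gen, latForm_latVec_last, if_neg hb, zero_smul, sub_zero]
  | one => exact latRep_one_apply _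
  | mul _ _ _ _ ha hb => rw [latRep_mul_apply, hb, ha]
  | inv a _ ha =>
    conv_lhs => rw [← ha]
    exact (latRoots i j k).rep_inv_rep a _

/-- The stabiliser of a dominant vector is generated by the simple reflections in the roots
orthogonal to it. Here those are all the nodes but the ringed one. -/
theorem mem_vertexGroup_iff (w : W i j k) : w ∈ vertexGroup i j k ↔
    latRep i j k w (latVec (.inl (Fin.last k))) = latVec (.inl (Fin.last k)) := by
  refine ⟨latRep_last_of_mem, fun h => ?_⟩
  have := (latRoots i j k).mem_closure_of_rep_eq (x := latVec (.inl (Fin.last k)))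
    (fun b => by
      change 0 ≤ latForm i j k _ (latRoot b)
      rw [latForm_latVec_last]
      split_ifs <;> simp) w h
  refine Subgroup.closure_mono (Set.image_mono fun b hb => ?_) this
  rw [Set.mem_ofPred_eq] at hb ⊢
  rintro rfl
  change latForm i j k _ (latRoot _) = 0 at hb
  rw [latForm_latVec_last, if_pos rfl] at hb
  exact one_ne_zero hb

/-- The lattice vector of a vertex. -/
noncomputable def vertexVec (v : Vertex i j k) : Lat i j k :=
  Quotient.liftOn' v (fun w => latRep i j k w (latVec (.inl (Fin.last k)))) fun a b h => by
    rw [QuotientGroup.leftRel_apply, mem_vertexGroup_iff] at h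
    conv_lhs => rw [← h]
    rw [← latRep_mul_apply, mul_inv_cancel_left]

theorem vertexVec_smul_base (w : W i j k) :
    vertexVec (w • base i j k) = latRep i j k w (latVec (.inl (Fin.last k))) := by
  change latRep i j k (w * 1) _ = _
  rw [mul_one]

theorem exists_smul_base (v : Vertex i j k) : ∃ w : W i j k, v = w • base i j k := by
  obtain ⟨w, rfl⟩ := QuotientGroup.mk_surjective v
  exact ⟨w, by change _ = ((w * 1 : W i j k) : Vertex i j k); rw [mul_one]⟩

theorem vertexVec_smul (w : W i j k) (v : Vertex i j k) :
    vertexVec (w • v) = latRep i j k w (vertexVec v) := by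
  obtain ⟨u, rfl⟩ := exists_smul_base v
  rw [← mul_smul, vertexVec_smul_base, vertexVec_smul_base, latRep_mul_apply]

theorem smul_base_eq_iff {u w : W i j k} :
    u • base i j k = w • base i j k ↔ u⁻¹ * w ∈ vertexGroup i j k := by
  rw [← QuotientGroup.eq]
  change ((u * 1 : W i j k) : Vertex i j k) = ((w * 1 : W i j k) : Vertex i j k) ↔ _
  rw [mul_one, mul_one]

theorem vertexVec_injective : Function.Injective (vertexVec : Vertex i j k → Lat i j k) := by
  intro u v h
  obtain ⟨a, rfl⟩ := exists_smul_base u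
  obtain ⟨b, rfl⟩ := exists_smul_base v
  rw [vertexVec_smul_base, vertexVec_smul_base] at h
  rw [smul_base_eq_iff, mem_vertexGroup_iff]
  apply latRep_injective a
  rw [← latRep_mul_apply, mul_inv_cancel_left, h]

theorem latRep_rWord (d : ℕ) (h : d ≤ k) :
    latRep i j k (rWord i j k d h) (latVec (.inl (Fin.last k))) =
      latVec (.inl ⟨k - d, by omega⟩) := by
  induction d with
  | zero => exact latRep_one_apply _
  | succ d ih =>
    rw [rWord, latRep_mul_apply, ih]
    -- The index is written as a successor so that the generator is recognised as some `r_{n+1}`,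
    -- which swaps the positions `n` and `n + 1`.
    have h1 : (⟨k - d, by omega⟩ : Fin (k + 1)) = ⟨k - (d + 1) + 1, by omega⟩ := by
      rw [Fin.mk.injEq]; omega
    rw [h1, latRep_r_succ_inl]
    congr 2
    exact Equiv.swap_apply_right _ _

theorem latRep_tWord (m : ℕ) (h : m ≤ i) (n : Fin (j + 1)) :
    latRep i j k (tWord i j k m h) (latVec (.inr (0, n))) =
      latVec (.inr (⟨m, by omega⟩, n)) := by
  induction m with
  | zero => exact latRep_one_apply _
  | succ m ih =>
    rw [tWord, latRep_mul_apply, ih, latRep_t_inr]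
    congr 3
    exact Equiv.swap_apply_left _ _

theorem latRep_sWord (n : ℕ) (h : n ≤ j) (m : Fin (i + 1)) :
    latRep i j k (sWord i j k n h) (latVec (.inr (m, 0))) =
      latVec (.inr (m, ⟨n, by omega⟩)) := by
  induction n with
  | zero => exact latRep_one_apply _
  | succ n ih =>
    rw [sWord, latRep_mul_apply, ih, latRep_s_inr]
    congr 3
    exact Equiv.swap_apply_left _ _

theorem vertexVec_vert (a : Entry i j k) : vertexVec (vert a) = latVec a := by
  rcases a with a | ⟨m, n⟩
  · rw [vert, vertexVec_smul_base, latRep_rWord]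
    congr 2
    ext
    change k - (k - a.val) = a.val
    omega
  · rw [vert, vertexVec_smul_base, latRep_mul_apply, latRep_rWord]
    have h0 : (⟨k - k, by omega⟩ : Fin (k + 1)) = 0 := by simp
    rw [h0, latRep_mul_apply, latRep_r_zero_inl_zero, latRep_mul_apply, latRep_tWord, latRep_sWord]

theorem vert_injective : Function.Injective (vert : Entry i j k → Vertex i j k) := fun a b h =>
  latVec_injective (by rw [← vertexVec_vert, h, vertexVec_vert])

theorem vert_last : (vert (.inl (Fin.last k)) : Vertex i j k) = base i j k := by
  apply vertexVec_injective
  rw [vertexVec_vert, ← one_smul (W i j k) (base i j k), vertexVec_smul_base, latRep_one_apply]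

theorem gen_mul_gen (b : Node i j k) : (gen b : W i j k) * gen b = 1 := by
  have := (coxeterMatrix i j k).toCoxeterSystem.simple_mul_simple_self b
  rwa [CoxeterMatrix.toCoxeterSystem_simple] at this

theorem gen_inv (b : Node i j k) : (gen b : W i j k)⁻¹ = gen b :=
  inv_eq_of_mul_eq_one_left (gen_mul_gen b)

theorem smul_vert_eq_iff {w : W i j k} {a : Entry i j k} {v : Vertex i j k} :
    w • vert a = v ↔ latRep i j k w (latVec a) = vertexVec v := by
  rw [← vertexVec_injective.eq_iff, vertexVec_smul, vertexVec_vert]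

theorem smul_vert_eq_vert_iff {w : W i j k} {a b : Entry i j k} :
    w • vert a = (vert b : Vertex i j k) ↔ latRep i j k w (latVec a) = latVec b := by
  rw [smul_vert_eq_iff, vertexVec_vert]

/-! ### Permutations of the indices -/

theorem exists_smul_vert_inl (π : Equiv.Perm (Fin (k + 1))) : ∃ w : W i j k,
    (∀ a, w • vert (.inl a) = (vert (.inl (π a)) : Vertex i j k)) ∧
      ∀ p, w • vert (.inr p) = (vert (.inr p) : Vertex i j k) := by
  have hπ : π ∈ Submonoid.closure (Set.range fun n : Fin k => Equiv.swap n.castSucc n.succ) := by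
    rw [Equiv.Perm.mclosure_swap_castSucc_succ]
    trivial
  induction hπ using Submonoid.closure_induction with
  | mem _ h =>
    obtain ⟨⟨n, hn⟩, rfl⟩ := h
    refine ⟨gen (.r ⟨n + 1, by omega⟩), fun a => ?_, fun p => ?_⟩
    · rw [smul_vert_eq_vert_iff, latRep_r_succ_inl]
      rfl
    · rw [smul_vert_eq_vert_iff, latRep_r_succ_inr]
  | one => exact ⟨1, by simp, by simp⟩
  | mul σ τ _ _ h1 h2 =>
    obtain ⟨v, hv, hv'⟩ := h1
    obtain ⟨w, hw, hw'⟩ := h2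
    exact ⟨v * w, by simp [mul_smul, hv, hw], by simp [mul_smul, hv', hw']⟩

theorem exists_smul_vert_fst (σ : Equiv.Perm (Fin (i + 1))) : ∃ w : W i j k,
    (∀ a, w • vert (.inl a) = (vert (.inl a) : Vertex i j k)) ∧
      ∀ m n, w • vert (.inr (m, n)) = (vert (.inr (σ m, n)) : Vertex i j k) := by
  have hσ : σ ∈ Submonoid.closure (Set.range fun n : Fin i => Equiv.swap n.castSucc n.succ) := by
    rw [Equiv.Perm.mclosure_swap_castSucc_succ]
    trivial
  induction hσ using Submonoid.closure_induction with
  | mem _ h =>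
    obtain ⟨n, rfl⟩ := h
    refine ⟨gen (.t n), fun a => ?_, fun m n => ?_⟩
    · rw [smul_vert_eq_vert_iff, latRep_t_inl]
    · rw [smul_vert_eq_vert_iff, latRep_t_inr]
      rfl
  | one => exact ⟨1, by simp, by simp⟩
  | mul σ τ _ _ h1 h2 =>
    obtain ⟨v, hv, hv'⟩ := h1
    obtain ⟨w, hw, hw'⟩ := h2
    exact ⟨v * w, by simp [mul_smul, hv, hw], by simp [mul_smul, hv', hw']⟩

theorem exists_smul_vert_snd (σ : Equiv.Perm (Fin (j + 1))) : ∃ w : W i j k,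
    (∀ a, w • vert (.inl a) = (vert (.inl a) : Vertex i j k)) ∧
      ∀ m n, w • vert (.inr (m, n)) = (vert (.inr (m, σ n)) : Vertex i j k) := by
  have hσ : σ ∈ Submonoid.closure (Set.range fun n : Fin j => Equiv.swap n.castSucc n.succ) := by
    rw [Equiv.Perm.mclosure_swap_castSucc_succ]
    trivial
  induction hσ using Submonoid.closure_induction with
  | mem _ h =>
    obtain ⟨n, rfl⟩ := h
    refine ⟨gen (.s n), fun a => ?_, fun m n => ?_⟩
    · rw [smul_vert_eq_vert_iff, latRep_s_inl]
    · rw [smul_vert_eq_vert_iff, latRep_s_inr]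
      rfl
  | one => exact ⟨1, by simp, by simp⟩
  | mul σ τ _ _ h1 h2 =>
    obtain ⟨v, hv, hv'⟩ := h1
    obtain ⟨w, hw, hw'⟩ := h2
    exact ⟨v * w, by simp [mul_smul, hv, hw], by simp [mul_smul, hv', hw']⟩

/-- Permutations of the indices are realised by symmetries of the figure. -/
theorem exists_smul_vert (π : Equiv.Perm (Fin (k + 1))) (σ : Equiv.Perm (Fin (i + 1)))
    (τ : Equiv.Perm (Fin (j + 1))) : ∃ w : W i j k,
    (∀ a, w • vert (.inl a) = (vert (.inl (π a)) : Vertex i j k)) ∧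
      ∀ m n, w • vert (.inr (m, n)) = (vert (.inr (σ m, τ n)) : Vertex i j k) := by
  obtain ⟨u, hu, hu'⟩ := exists_smul_vert_inl (i := i) (j := j) π
  obtain ⟨v, hv, hv'⟩ := exists_smul_vert_fst (j := j) (k := k) σ
  obtain ⟨w, hw, hw'⟩ := exists_smul_vert_snd (i := i) (k := k) τ
  exact ⟨u * v * w, by simp [mul_smul, hu, hv, hw], by simp [mul_smul, hu', hv', hw']⟩

/-! ### Edges -/

theorem Adj.smul {u v : Vertex i j k} (h : Adj u v) (w : W i j k) : Adj (w • u) (w • v) := by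
  obtain ⟨x, rfl, rfl⟩ := h
  exact ⟨w * x, by rw [mul_smul], by rw [mul_assoc, mul_smul w]⟩

theorem Adj.symm {u v : Vertex i j k} (h : Adj u v) : Adj v u := by
  obtain ⟨x, rfl, rfl⟩ := h
  exact ⟨x * gen (.r (Fin.last k)), rfl, by rw [mul_assoc x, gen_mul_gen, mul_one]⟩

theorem adj_smul_iff {u v : Vertex i j k} (w : W i j k) : Adj (w • u) (w • v) ↔ Adj u v :=
  ⟨fun h => by simpa using h.smul w⁻¹, fun h => h.smul w⟩

theorem Adj.latForm_sub {u v : Vertex i j k} (h : Adj u v) :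
    latForm i j k (vertexVec u - vertexVec v) (vertexVec u - vertexVec v) = 2 := by
  obtain ⟨w, rfl, rfl⟩ := h
  rw [vertexVec_smul_base, vertexVec_smul_base, latRep_mul_apply, ← map_sub, latForm_latRep,
    latRep_gen, latForm_latVec_last, if_pos rfl, one_smul, sub_sub_cancel, latForm_root_self]

theorem adj_base_smul :
    Adj (base i j k) ((gen (.r (Fin.last k)) : W i j k) • base i j k) :=
  ⟨1, by rw [one_smul], by rw [one_mul]⟩

theorem Adj.vert_perm {a b a' b' : Entry i j k} (h : Adj (vert a) (vert b : Vertex i j k))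
    (w : W i j k) (ha : w • vert a = (vert a' : Vertex i j k))
    (hb : w • vert b = (vert b' : Vertex i j k)) : Adj (vert a') (vert b' : Vertex i j k) := by
  rw [← ha, ← hb]
  exact h.smul w

theorem exists_perm_map {α : Type*} [DecidableEq α] {a b c d : α} (h : a ≠ b) (h' : c ≠ d) :
    ∃ σ : Equiv.Perm α, σ a = c ∧ σ b = d := by
  refine ⟨Equiv.swap a c * Equiv.swap b (Equiv.swap a c d), ?_, ?_⟩
  · have : a ≠ Equiv.swap a c d := fun h0 => h' (by
      simpa using congrArg (Equiv.swap a c) h0)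
    simp [Equiv.swap_apply_of_ne_of_ne h this]
  · simp

theorem adj_inl_inl {a b : Fin (k + 1)} (h : a ≠ b) :
    Adj (vert (.inl a)) (vert (.inl b) : Vertex i j k) := by
  obtain _ | k := k
  · omega
  have hne : Fin.last (k + 1) ≠ (Fin.last k).castSucc := by simp [Fin.ext_iff]
  obtain ⟨π, h1, h2⟩ := exists_perm_map hne h
  obtain ⟨w, hw, -⟩ := exists_smul_vert_inl (i := i) (j := j) π
  have h0 := adj_base_smul (i := i) (j := j) (k := k + 1)
  rw [← vert_last, (smul_vert_eq_vert_iff (b := .inl (Fin.last k).castSucc)).mpr] at h0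
  · exact h0.vert_perm w (by rw [hw, h1]) (by rw [hw, h2])
  · change latRep i j (k + 1) (gen (.r ⟨k + 1, _⟩)) _ = _
    rw [latRep_r_succ_inl]
    congr 2
    exact Equiv.swap_apply_right _ _

/-- If `k = 0` the ringed node is `r 0` and this is the base edge. Otherwise `r 0` carries the edge
from `y_1` to `y_0` to one from `y_1` to `y_00`, and a permutation of the first array finishes. -/
theorem adj_inl_zero_inr_zero : Adj (vert (.inl 0)) (vert (.inr (0, 0)) : Vertex i j k) := by
  obtain _ | k := k
  · have h0 := adj_base_smul (i := i) (j := j) (k := 0)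
    rw [← vert_last] at h0
    change Adj (vert (.inl 0)) ((gen (.r 0) : W i j 0) • vert (.inl 0)) at h0
    rwa [smul_vert_eq_vert_iff.mpr latRep_r_zero_inl_zero] at h0
  · have h0 := adj_inl_inl (i := i) (j := j) (k := k + 1) (a := 1) (b := 0) (by simp)
    have h1 := h0.vert_perm (gen (.r 0))
      (smul_vert_eq_vert_iff.mpr (latRep_r_zero_inl (by simp)))
      (smul_vert_eq_vert_iff.mpr latRep_r_zero_inl_zero)
    obtain ⟨w, hw, hw'⟩ := exists_smul_vert_inl (i := i) (j := j) (Equiv.swap (1 : Fin (k + 2)) 0)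
    exact h1.vert_perm w (by rw [hw, Equiv.swap_apply_left]) (hw' _)

theorem adj_inl_inr (a : Fin (k + 1)) (p : Fin (i + 1) × Fin (j + 1)) :
    Adj (vert (.inl a)) (vert (.inr p) : Vertex i j k) := by
  obtain ⟨w, hw, hw'⟩ := exists_smul_vert (Equiv.swap 0 a) (Equiv.swap 0 p.1) (Equiv.swap 0 p.2)
  exact adj_inl_zero_inr_zero.vert_perm w (by rw [hw, Equiv.swap_apply_left])
    (by rw [hw', Equiv.swap_apply_left, Equiv.swap_apply_left])

theorem adj_inr_inr {p q : Fin (i + 1) × Fin (j + 1)} (h : p ≠ q)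
    (hpq : p.1 = q.1 ∨ p.2 = q.2) : Adj (vert (.inr p)) (vert (.inr q) : Vertex i j k) := by
  -- `r 0` fixes such an entry `q` and sends `y_0` to `y_00`, so it moves a known edge between the
  -- arrays into the second array.
  have h0 : ∀ q : Fin (i + 1) × Fin (j + 1), q ≠ (0, 0) → q.1 = 0 ∨ q.2 = 0 →
      Adj (vert (.inr (0, 0))) (vert (.inr q) : Vertex i j k) := fun q h1 h2 =>
    (adj_inl_inr 0 q).vert_perm (gen (.r 0)) (smul_vert_eq_vert_iff.mpr latRep_r_zero_inl_zero)
      (smul_vert_eq_vert_iff.mpr (latRep_r_zero_inr h1 h2))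
  obtain ⟨w, -, hw⟩ := exists_smul_vert (k := k) 1 (Equiv.swap 0 p.1) (Equiv.swap 0 p.2)
  refine (h0 (Equiv.swap 0 p.1 q.1, Equiv.swap 0 p.2 q.2) ?_ ?_).vert_perm w
    (by rw [hw, Equiv.swap_apply_left, Equiv.swap_apply_left]) (by simp [hw])
  · rw [ne_eq, Prod.ext_iff] at h ⊢
    rintro ⟨h1, h2⟩
    simp only [Equiv.swap_apply_eq_iff, Equiv.swap_apply_left] at h1 h2
    exact h ⟨h1.symm, h2.symm⟩
  · rcases hpq with h | h <;> rw [← h] <;> simp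

theorem latForm_sub_eq_four {m m' : Fin (i + 1)} {n n' : Fin (j + 1)} (hm : m ≠ m')
    (hn : n ≠ n') : latForm i j k (latVec (.inr (m, n)) - latVec (.inr (m', n')))
      (latVec (.inr (m, n)) - latVec (.inr (m', n'))) = 4 := by
  simp [latForm_apply, latVec, dotProduct_sub, hm, hn, hm.symm, hn.symm]

/-- Non-adjacency is read off the form: an edge needs a difference of norm 2, while equal entries
give 0 and entries sharing neither row nor column give 4. -/
theorem adj_vert_iff (a b : Entry i j k) :
    Adj (vert a) (vert b : Vertex i j k) ↔ SimplexAdj a b := by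
  have irr : ∀ v : Vertex i j k, ¬ Adj v v := fun v h => by
    have := h.latForm_sub
    simp at this
  rcases a with a | p <;> rcases b with b | q
  · exact ⟨fun h hab => irr _ (by rwa [hab] at h), adj_inl_inl⟩
  · exact ⟨fun _ => trivial, fun _ => adj_inl_inr _ _⟩
  · exact ⟨fun _ => trivial, fun _ => (adj_inl_inr _ _).symm⟩
  · refine ⟨fun h => ⟨fun hab => irr _ (by rwa [hab] at h), ?_⟩, fun h => adj_inr_inr h.1 h.2⟩
    by_contra! hne
    have := h.latForm_sub
    rw [vertexVec_vert, vertexVec_vert, latForm_sub_eq_four hne.1 hne.2] at this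
    norm_num at this

/-! ### Facets -/

/-- The sum of the vectors of two opposing vertices of the standard `k_{1,1}`-facet, where `m` and
`n` are the indices with value one. -/
def crossSum (m : Fin (i + 1)) (n : Fin (j + 1)) : Lat i j k :=
  latVec (.inr (0, 0)) + latVec (.inr (m, n))

/-- The vectors of the vertices of the standard `k_{1,1}`-facet. -/
def IsCrossVec (m : Fin (i + 1)) (n : Fin (j + 1)) (x : Lat i j k) : Prop :=
  (∃ a, x = latVec (.inl a)) ∨
  (∃ a, x = crossSum m n - latVec (.inl a)) ∨
  ∃ p : Fin (i + 1) × Fin (j + 1), (p.1 = 0 ∨ p.1 = m) ∧ (p.2 = 0 ∨ p.2 = n) ∧ x = latVec (.inr p)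

/-- The two diagonals of a rectangle of entries have equal sums. This puts two axes of a facet on
the same footing and later gives the product relation between monomials. -/
theorem latVec_add_latVec (m : Fin (i + 1)) (n : Fin (j + 1)) :
    latVec (.inr (m, 0)) + latVec (.inr (0, n)) = (crossSum m n : Lat i j k) := by
  simp only [crossSum, latVec, Prod.mk_add_mk, add_zero]
  rw [add_comm (Pi.single m 1)]

section Facet

variable {m : Fin (i + 1)} {n : Fin (j + 1)}

theorem crossSum_sub_inr_zero (m : Fin (i + 1)) (n : Fin (j + 1)) :
    (crossSum m n : Lat i j k) - latVec (.inr (0, 0)) = latVec (.inr (m, n)) :=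
  add_sub_cancel_left _ _

theorem crossSum_sub_inr (m : Fin (i + 1)) (n : Fin (j + 1)) :
    (crossSum m n : Lat i j k) - latVec (.inr (m, n)) = latVec (.inr (0, 0)) :=
  add_sub_cancel_right _ _

theorem crossSum_sub_inr_fst (m : Fin (i + 1)) (n : Fin (j + 1)) :
    (crossSum m n : Lat i j k) - latVec (.inr (m, 0)) = latVec (.inr (0, n)) := by
  rw [← latVec_add_latVec, add_sub_cancel_left]

theorem crossSum_sub_inr_snd (m : Fin (i + 1)) (n : Fin (j + 1)) :
    (crossSum m n : Lat i j k) - latVec (.inr (0, n)) = latVec (.inr (m, 0)) := by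
  rw [← latVec_add_latVec, add_sub_cancel_right]

/-- The sum is orthogonal to all roots of the `k_{1,1}` diagram: at the branch node the two summands
pair to `-1` and `1`. It thus plays the part of twice the centre of the cross-polytope. -/
theorem latRep_gen_crossSum (hm : m.val = 1) (hn : n.val = 1) {b : Node i j k} (hb : b.IsCross) :
    latRep i j k (gen b) (crossSum m n) = crossSum m n := by
  have hm0 : m ≠ 0 := fun h => by simp [h] at hm
  have hn0 : n ≠ 0 := fun h => by simp [h] at hn
  rcases b with ⟨_ | a, h⟩ | a | a
  · rw [latRep_gen, crossSum, map_add, AddMonoidHom.add_apply, latForm_latVec_inr_r_zero,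
      latForm_latVec_inr_r_zero]
    simp [hm0, hn0]
  · rw [crossSum, map_add, latRep_r_succ_inr, latRep_r_succ_inr]
  · rw [Node.IsCross] at hb
    have h1 : n = a.succ := by ext; simp [hn, hb]
    have h0 : (0 : Fin (j + 1)) = a.castSucc := by ext; simp [hb]
    rw [latRep_gen, latForm_root_s, ← h1, ← h0]
    simp [crossSum, latVec, hn0, hn0.symm]
  · rw [Node.IsCross] at hb
    have h1 : m = a.succ := by ext; simp [hm, hb]
    have h0 : (0 : Fin (i + 1)) = a.castSucc := by ext; simp [hb]
    rw [latRep_gen, latForm_root_t, ← h1, ← h0]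
    simp [crossSum, latVec, hm0, hm0.symm]

theorem latRep_r_zero_cross (hm : m.val = 1) (hn : n.val = 1) :
    latRep i j k (gen (.r 0)) (latVec (.inr (m, n))) = crossSum m n - latVec (.inl 0) := by
  have hm0 : m ≠ 0 := fun h => by simp [h] at hm
  have hn0 : n ≠ 0 := fun h => by simp [h] at hn
  rw [latRep_r_zero_inr_of_ne hm0 hn0, latVec_add_latVec]

/-- `r 0` exchanges the vector of `y_0` with that of `y_00`, and that of `y_mn` with the antipode of
`y_0`; the other generators permute indices. The list therefore contains the whole orbit of the base
vector. -/
theorem IsCrossVec.latRep_gen (hm : m.val = 1) (hn : n.val = 1) {x : Lat i j k}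
    (hx : IsCrossVec m n x) {b : Node i j k} (hb : b.IsCross) :
    IsCrossVec m n (latRep i j k (gen b) x) := by
  have hm0 : m ≠ 0 := fun h => by simp [h] at hm
  have hn0 : n ≠ 0 := fun h => by simp [h] at hn
  have hinl : ∀ a, (∃ a', latRep i j k (gen b) (latVec (.inl a)) = latVec (.inl a')) ∨
      latRep i j k (gen b) (latVec (.inl a)) = latVec (.inr (0, 0)) := by
    intro a
    rcases b with ⟨_ | l, h⟩ | l | l
    · by_cases ha : a = 0
      · rw [ha]
        exact .inr latRep_r_zero_inl_zero
      · exact .inl ⟨_, latRep_r_zero_inl ha⟩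
    · exact .inl ⟨_, latRep_r_succ_inl _ _ _⟩
    · exact .inl ⟨_, latRep_s_inl _ _⟩
    · exact .inl ⟨_, latRep_t_inl _ _⟩
  rcases hx with ⟨a, rfl⟩ | ⟨a, rfl⟩ | ⟨⟨m', n'⟩, h1, h2, rfl⟩
  · rcases hinl a with ⟨a', h⟩ | h
    · exact .inl ⟨a', h⟩
    · exact .inr (.inr ⟨_, .inl rfl, .inl rfl, h⟩)
  · rw [map_sub, latRep_gen_crossSum hm hn hb]
    rcases hinl a with ⟨a', h⟩ | h
    · exact .inr (.inl ⟨a', by rw [h]⟩)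
    · exact .inr (.inr ⟨_, .inr rfl, .inr rfl, by rw [h, crossSum_sub_inr_zero]⟩)
  · simp only at h1 h2
    rcases b with ⟨_ | l, h⟩ | l | l
    · by_cases h0 : (m', n') = (0, 0)
      · rw [h0]
        exact .inl ⟨0, latRep_r_zero_inr_zero⟩
      · by_cases h3 : m' = 0 ∨ n' = 0
        · exact .inr (.inr ⟨_, h1, h2, latRep_r_zero_inr h0 h3⟩)
        · rw [not_or] at h3
          obtain rfl := h1.resolve_left h3.1
          obtain rfl := h2.resolve_left h3.2
          exact .inr (.inl ⟨0, latRep_r_zero_cross hm hn⟩)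
    · exact .inr (.inr ⟨_, h1, h2, latRep_r_succ_inr _ _ _⟩)
    · rw [Node.IsCross] at hb
      have h3 : n = l.succ := by ext; simp [hn, hb]
      have h4 : (0 : Fin (j + 1)) = l.castSucc := by ext; simp [hb]
      refine .inr (.inr ⟨_, h1, ?_, latRep_s_inr _ _⟩)
      simp only [adjSwap, ← h3, ← h4]
      rcases h2 with rfl | rfl <;> simp
    · rw [Node.IsCross] at hb
      have h3 : m = l.succ := by ext; simp [hm, hb]
      have h4 : (0 : Fin (i + 1)) = l.castSucc := by ext; simp [hb]
      refine .inr (.inr ⟨_, ?_, h2, latRep_t_inr _ _⟩)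
      simp only [adjSwap, ← h3, ← h4]
      rcases h1 with rfl | rfl <;> simp

theorem latRep_crossGroup (hm : m.val = 1) (hn : n.val = 1) {u : W i j k}
    (hu : u ∈ crossGroup i j k) :
    latRep i j k u (crossSum m n) = crossSum m n ∧
      ∀ x, IsCrossVec m n x → IsCrossVec m n (latRep i j k u x) := by
  induction hu using Subgroup.closure_induction_left with
  | one => exact ⟨latRep_one_apply _, fun x hx => by rwa [latRep_one_apply]⟩
  | mul_left _ h v _ ih =>
    obtain ⟨b, hb, rfl⟩ := h
    refine ⟨by rw [latRep_mul_apply, ih.1, latRep_gen_crossSum hm hn hb], fun x hx => ?_⟩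
    rw [latRep_mul_apply]
    exact (ih.2 x hx).latRep_gen hm hn hb
  | inv_mul_cancel _ h v _ ih =>
    obtain ⟨b, hb, rfl⟩ := h
    rw [gen_inv]
    refine ⟨by rw [latRep_mul_apply, ih.1, latRep_gen_crossSum hm hn hb], fun x hx => ?_⟩
    rw [latRep_mul_apply]
    exact (ih.2 x hx).latRep_gen hm hn hb

theorem exists_smul_vert_swap (a : Fin (k + 1)) : ∃ w : W i j k,
    w • vert (.inl 0) = (vert (.inl a) : Vertex i j k) ∧
    (∀ p, w • vert (.inr p) = (vert (.inr p) : Vertex i j k)) ∧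
    ∀ b ≠ a, ∃ b' ≠ 0, w • vert (.inl b') = (vert (.inl b) : Vertex i j k) := by
  obtain ⟨w, hw, hw'⟩ := exists_smul_vert_inl (i := i) (j := j) (Equiv.swap 0 a)
  refine ⟨w, by rw [hw, Equiv.swap_apply_left], hw', fun b hb => ⟨Equiv.swap 0 a b, ?_, ?_⟩⟩
  · rwa [ne_eq, Equiv.swap_apply_eq_iff, Equiv.swap_apply_left]
  · rw [hw, Equiv.swap_apply_self]

/-- Exhibits the antipode of `y_a`, which is not an array entry, as the vertex of `y_mn` moved by `r
0` and then by a permutation of the first array. -/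
theorem vertexVec_swap (hm : m.val = 1) (hn : n.val = 1) {a : Fin (k + 1)} {w : W i j k}
    (h1 : w • vert (.inl 0) = (vert (.inl a) : Vertex i j k))
    (h2 : ∀ p, w • vert (.inr p) = (vert (.inr p) : Vertex i j k)) :
    vertexVec ((w * gen (.r 0)) • vert (.inr (m, n))) = crossSum m n - latVec (.inl a) := by
  rw [smul_vert_eq_vert_iff] at h1
  have h3 := smul_vert_eq_vert_iff.mp (h2 (0, 0))
  have h4 := smul_vert_eq_vert_iff.mp (h2 (m, n))
  rw [vertexVec_smul, latRep_mul_apply, vertexVec_vert, latRep_r_zero_cross hm hn, map_sub, h1,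
    crossSum, map_add, h3, h4]

/-- The vectors of opposing vertices of the standard facet have a constant sum. -/
theorem vertexVec_add_of_opposing (hm : m.val = 1) (hn : n.val = 1) {a b : W i j k}
    (ha : a ∈ crossGroup i j k) (hb : b ∈ crossGroup i j k) (hne : a • base i j k ≠ b • base i j k)
    (hadj : ¬ Adj (a • base i j k) (b • base i j k)) :
    vertexVec (b • base i j k) = crossSum m n - vertexVec (a • base i j k) := by
  -- Translation by `a⁻¹` makes one of the two vertices the base vertex. It then suffices that every
  -- other facet vertex except the antipode is joined to it.
  obtain ⟨d, rfl⟩ : ∃ d, b = a * d := ⟨a⁻¹ * b, by rw [mul_inv_cancel_left]⟩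
  have hd : d ∈ crossGroup i j k := by simpa using mul_mem (inv_mem ha) hb
  rw [mul_smul, adj_smul_iff] at hadj
  rw [mul_smul, ne_eq, smul_left_cancel_iff] at hne
  have hx : IsCrossVec m n (vertexVec (d • base i j k)) := by
    rw [vertexVec_smul_base]
    exact (latRep_crossGroup hm hn hd).2 _ (.inl ⟨_, rfl⟩)
  suffices h : vertexVec (d • base i j k) = crossSum m n - latVec (.inl (Fin.last k)) by
    rw [mul_smul, vertexVec_smul, h, map_sub, (latRep_crossGroup hm hn ha).1, vertexVec_smul_base]
  rw [← vert_last] at hne hadj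
  rcases hx with ⟨c, hc⟩ | ⟨c, hc⟩ | ⟨p, -, -, hc⟩
  · rw [← vertexVec_vert, vertexVec_injective.eq_iff, ← vert_last] at hc
    rw [hc] at hne hadj
    by_cases h : Fin.last k = c
    · rw [h] at hne
      exact absurd rfl hne
    · exact absurd (adj_inl_inl h) hadj
  · by_cases h : Fin.last k = c
    · rw [hc, h]
    · obtain ⟨w, h1, h2, h3⟩ := exists_smul_vert_swap (i := i) (j := j) c
      obtain ⟨c', h0, h4⟩ := h3 _ h
      rw [← vertexVec_swap hm hn h1 h2, vertexVec_injective.eq_iff] at hc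
      -- The base vertex is the image of `y_{c'}` under `w`, and `r 0` fixes `y_{c'}`. Cancelling
      -- `w` and `r 0` leaves an edge between the two arrays, contradicting non-adjacency.
      have h5 : (gen (.r 0) : W i j k) • vert (.inl c') = (vert (.inl c') : Vertex i j k) :=
        smul_vert_eq_vert_iff.mpr (latRep_r_zero_inl h0)
      rw [vert_last] at hadj
      rw [hc, ← vert_last, ← h4, ← h5, mul_smul, adj_smul_iff, adj_smul_iff] at hadj
      exact absurd (adj_inl_inr _ _) hadj
  · rw [← vertexVec_vert, vertexVec_injective.eq_iff, ← vert_last] at hc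
    rw [hc] at hadj
    exact absurd (adj_inl_inr _ _) hadj

/-- The pairs of opposing vertices of a facet. -/
theorem Opposing.cases (hm : m.val = 1) (hn : n.val = 1) {w : W i j k}
    {u v : Vertex i j k} (h : Opposing w u v) :
    ∃ w' : W i j k, (∀ p, w' • vert (.inr p) = (w • vert (.inr p) : Vertex i j k)) ∧
      ((u = w' • vert (.inr (0, 0)) ∧ v = w' • vert (.inr (m, n))) ∨
      (u = w' • vert (.inr (m, n)) ∧ v = w' • vert (.inr (0, 0))) ∨
      (u = w' • vert (.inr (0, n)) ∧ v = w' • vert (.inr (m, 0))) ∨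
      (u = w' • vert (.inr (m, 0)) ∧ v = w' • vert (.inr (0, n))) ∨
      (u = w' • vert (.inl 0) ∧ v = (w' * gen (.r 0)) • vert (.inr (m, n))) ∨
      (u = (w' * gen (.r 0)) • vert (.inr (m, n)) ∧ v = w' • vert (.inl 0))) := by
  obtain ⟨⟨a, ha, rfl⟩, ⟨b, hb, rfl⟩, hne, hadj⟩ := h
  rw [mul_smul, mul_smul, ne_eq, smul_left_cancel_iff] at hne
  rw [mul_smul, mul_smul, adj_smul_iff] at hadj
  have hab := vertexVec_add_of_opposing hm hn ha hb hne hadj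
  have hx : IsCrossVec m n (vertexVec (a • base i j k)) := by
    rw [vertexVec_smul_base]
    exact (latRep_crossGroup hm hn ha).2 _ (.inl ⟨_, rfl⟩)
  simp only [mul_smul w a, mul_smul w b]
  rcases hx with ⟨c, hc⟩ | ⟨c, hc⟩ | ⟨⟨p, q⟩, hp, hq, hc⟩
  -- The axis through `y_c` becomes the axis through `y_0` on replacing `w` by `w x`, which has the
  -- same effect on the second array.
  · obtain ⟨x, h1, h2, -⟩ := exists_smul_vert_swap (i := i) (j := j) c
    rw [hc, ← vertexVec_swap hm hn h1 h2, vertexVec_injective.eq_iff] at hab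
    rw [← vertexVec_vert, vertexVec_injective.eq_iff] at hc
    exact ⟨w * x, fun p => by rw [mul_smul, h2], .inr (.inr (.inr (.inr (.inl
      ⟨by rw [hc, mul_smul, h1], by rw [hab, mul_assoc, mul_smul w]⟩))))⟩
  · obtain ⟨x, h1, h2, -⟩ := exists_smul_vert_swap (i := i) (j := j) c
    rw [hc, sub_sub_cancel, ← vertexVec_vert, vertexVec_injective.eq_iff] at hab
    rw [← vertexVec_swap hm hn h1 h2, vertexVec_injective.eq_iff] at hc
    exact ⟨w * x, fun p => by rw [mul_smul, h2], .inr (.inr (.inr (.inr (.inr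
      ⟨by rw [hc, mul_assoc, mul_smul w], by rw [hab, mul_smul, h1]⟩))))⟩
  · refine ⟨w, fun _ => rfl, ?_⟩
    rw [hc] at hab
    rw [← vertexVec_vert, vertexVec_injective.eq_iff] at hc
    rw [hc]
    simp only at hp hq
    rcases hp with rfl | rfl <;> rcases hq with rfl | rfl
    · rw [crossSum_sub_inr_zero, ← vertexVec_vert, vertexVec_injective.eq_iff] at hab
      exact .inl ⟨rfl, by rw [hab]⟩
    · rw [crossSum_sub_inr_snd, ← vertexVec_vert, vertexVec_injective.eq_iff] at hab
      exact .inr (.inr (.inl ⟨rfl, by rw [hab]⟩))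
    · rw [crossSum_sub_inr_fst, ← vertexVec_vert, vertexVec_injective.eq_iff] at hab
      exact .inr (.inr (.inr (.inl ⟨rfl, by rw [hab]⟩)))
    · rw [crossSum_sub_inr, ← vertexVec_vert, vertexVec_injective.eq_iff] at hab
      exact .inr (.inl ⟨rfl, by rw [hab]⟩)

theorem latForm_crossSum_sub (hm : m.val = 1) (hn : n.val = 1) :
    latForm i j k (latVec (.inl 0) - (crossSum m n - latVec (.inl 0)))
    (latVec (.inl 0) - (crossSum m n - latVec (.inl 0))) = 4 := by
  have hm0 : m ≠ 0 := fun h => by simp [h] at hm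
  have hn0 : n ≠ 0 := fun h => by simp [h] at hn
  simp [latForm_apply, latVec, crossSum, dotProduct_add, hm0, hn0, hm0.symm,
    hn0.symm, Finset.sum_add_distrib]

theorem rWord_mem_crossGroup (d : ℕ) (h : d ≤ k) : rWord i j k d h ∈ crossGroup i j k := by
  induction d with
  | zero => exact one_mem _
  | succ d ih => exact mul_mem (Subgroup.subset_closure ⟨.r _, trivial, rfl⟩) (ih _)

theorem gen_smul_mem_crossFacet {b : Node i j k} (hb : b.IsCross) {v : Vertex i j k}
    (hv : v ∈ crossFacet (1 : W i j k)) : (gen b : W i j k) • v ∈ crossFacet (1 : W i j k) := by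
  obtain ⟨u, hu, rfl⟩ := hv
  exact ⟨gen b * u, mul_mem (Subgroup.subset_closure ⟨b, hb, rfl⟩) hu, by
    rw [one_mul, one_mul, mul_smul]⟩

theorem vert_inl_mem_crossFacet (a : Fin (k + 1)) :
    vert (.inl a) ∈ crossFacet (1 : W i j k) :=
  ⟨_, rWord_mem_crossGroup _ _, by rw [one_mul]; rfl⟩

/-- The three axes of the standard facet that meet the array entries or the image of the array
under the reflection in the branch node. -/
theorem opposing_one (hm : m.val = 1) (hn : n.val = 1) :
    Opposing (1 : W i j k) (vert (.inr (0, 0))) (vert (.inr (m, n))) ∧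
    Opposing (1 : W i j k) (vert (.inr (0, n))) (vert (.inr (m, 0))) ∧
    Opposing (1 : W i j k) (vert (.inl 0)) ((gen (.r 0) : W i j k) • vert (.inr (m, n))) := by
  have hm0 : m ≠ 0 := fun h => by simp [h] at hm
  have hn0 : n ≠ 0 := fun h => by simp [h] at hn
  have h00 : vert (.inr (0, 0)) ∈ crossFacet (1 : W i j k) := by
    rw [← smul_vert_eq_vert_iff.mpr latRep_r_zero_inl_zero]
    exact gen_smul_mem_crossFacet (b := .r 0) trivial (vert_inl_mem_crossFacet 0)
  have ht : ∀ q, vert (.inr (0, q)) ∈ crossFacet (1 : W i j k) →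
      vert (.inr (m, q)) ∈ crossFacet (1 : W i j k) := fun q hq => by
    have h := gen_smul_mem_crossFacet (b := .t ⟨0, by omega⟩) rfl hq
    rwa [smul_vert_eq_vert_iff.mpr (latRep_t_inr _ _), adjSwap,
      show (0 : Fin (i + 1)) = Fin.castSucc ⟨0, by omega⟩ from rfl, Equiv.swap_apply_left,
      show Fin.succ ⟨0, _⟩ = m from Fin.ext hm.symm] at h
  have h01 : vert (.inr (0, n)) ∈ crossFacet (1 : W i j k) := by
    have h := gen_smul_mem_crossFacet (b := .s ⟨0, by omega⟩) rfl h00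
    rwa [smul_vert_eq_vert_iff.mpr (latRep_s_inr _ _), adjSwap,
      show (0 : Fin (j + 1)) = Fin.castSucc ⟨0, by omega⟩ from rfl, Equiv.swap_apply_left,
      show Fin.succ ⟨0, _⟩ = n from Fin.ext hn.symm] at h
  have h10 := ht _ h00
  have h11 := ht _ h01
  -- Norm 4 excludes both coincidence (norm 0) and an edge (norm 2).
  have key : ∀ {u v : Vertex i j k}, u ∈ crossFacet (1 : W i j k) → v ∈ crossFacet (1 : W i j k) →
      latForm i j k (vertexVec u - vertexVec v) (vertexVec u - vertexVec v) = 4 →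
      Opposing (1 : W i j k) u v := fun {u v} hu hv h => by
    refine ⟨hu, hv, ?_, fun hadj => ?_⟩
    · rintro rfl
      simp at h
    · rw [hadj.latForm_sub] at h
      norm_num at h
  refine ⟨key h00 h11 ?_, key h01 h10 ?_, key (vert_inl_mem_crossFacet 0)
    (gen_smul_mem_crossFacet (b := .r 0) trivial h11) ?_⟩
  · rw [vertexVec_vert, vertexVec_vert, latForm_sub_eq_four hm0.symm hn0.symm]
  · rw [vertexVec_vert, vertexVec_vert, latForm_sub_eq_four hm0.symm hn0]
  · rw [vertexVec_smul, vertexVec_vert, vertexVec_vert, latRep_r_zero_cross hm hn,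
      latForm_crossSum_sub hm hn]

theorem Opposing.smul {w : W i j k} {u v : Vertex i j k} (h : Opposing w u v) (x : W i j k) :
    Opposing (x * w) (x • u) (x • v) := by
  obtain ⟨⟨a, ha, rfl⟩, ⟨b, hb, rfl⟩, hne, hadj⟩ := h
  refine ⟨⟨a, ha, by rw [mul_assoc, mul_smul x]⟩, ⟨b, hb, by rw [mul_assoc, mul_smul x]⟩, ?_, ?_⟩
  · rwa [ne_eq, smul_left_cancel_iff]
  · rwa [adj_smul_iff]

end Facet

/-! ### Values of rational functions -/

section Value

variable {F L : Type*} [Field F] [Field L] [Algebra F L] {y : Entry i j k → L}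
  {f f₁ f₂ : RatField i j k F} {z z₁ z₂ : L}

theorem algebraMap_ratField_ne_zero {q : MvPolynomial (Entry i j k) F} (hq : q ≠ 0) :
    algebraMap _ (RatField i j k F) q ≠ 0 := by
  rwa [ne_eq, FaithfulSMul.algebraMap_eq_zero_iff]

theorem ne_zero_of_aeval_ne_zero {q : MvPolynomial (Entry i j k) F}
    (hq : MvPolynomial.aeval y q ≠ 0) : q ≠ 0 := by
  rintro rfl
  exact hq (map_zero _)

theorem hasValueAt_iff_eq_div : HasValueAt f y z ↔ ∃ p q : MvPolynomial (Entry i j k) F,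
    MvPolynomial.aeval y q ≠ 0 ∧ f = algebraMap _ _ p / algebraMap _ _ q ∧
    z = MvPolynomial.aeval y p / MvPolynomial.aeval y q := by
  unfold HasValueAt
  refine exists₂_congr fun p q => and_congr_right fun hq => and_congr_left fun _ => ?_
  rw [eq_div_iff (algebraMap_ratField_ne_zero (ne_zero_of_aeval_ne_zero hq))]

/-- Cross-multiplied fractions give a polynomial identity, which survives evaluation. Specialisation
can therefore separate rational functions. -/
theorem HasValueAt.unique (h₁ : HasValueAt f y z₁) (h₂ : HasValueAt f y z₂) : z₁ = z₂ := by
  obtain ⟨p₁, q₁, hq₁, hf₁, rfl⟩ := hasValueAt_iff_eq_div.mp h₁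
  obtain ⟨p₂, q₂, hq₂, hf₂, rfl⟩ := hasValueAt_iff_eq_div.mp h₂
  rw [hf₁, div_eq_div_iff (algebraMap_ratField_ne_zero (ne_zero_of_aeval_ne_zero hq₁))
    (algebraMap_ratField_ne_zero (ne_zero_of_aeval_ne_zero hq₂)), ← map_mul, ← map_mul] at hf₂
  have := FaithfulSMul.algebraMap_injective _ _ hf₂
  rw [div_eq_div_iff hq₁ hq₂, ← map_mul, this, map_mul]

theorem hasValueAt_algebraMap (p : MvPolynomial (Entry i j k) F) :
    HasValueAt (algebraMap _ (RatField i j k F) p) y (MvPolynomial.aeval y p) :=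
  ⟨p, 1, by simp, by simp, by simp⟩

theorem hasValueAt_indet (a : Entry i j k) : HasValueAt (indet i j k F a) y (y a) := by
  have := hasValueAt_algebraMap (y := y) (MvPolynomial.X (R := F) a)
  rwa [MvPolynomial.aeval_X] at this

theorem hasValueAt_zero : HasValueAt (0 : RatField i j k F) y 0 := by
  simpa using hasValueAt_algebraMap (y := y) (0 : MvPolynomial (Entry i j k) F)

theorem HasValueAt.add (h₁ : HasValueAt f₁ y z₁) (h₂ : HasValueAt f₂ y z₂) :
    HasValueAt (f₁ + f₂) y (z₁ + z₂) := by
  obtain ⟨p₁, q₁, hq₁, hf₁, rfl⟩ := h₁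
  obtain ⟨p₂, q₂, hq₂, hf₂, rfl⟩ := h₂
  refine ⟨p₁ * q₂ + p₂ * q₁, q₁ * q₂, by simp [hq₁, hq₂], ?_, ?_⟩
  · simp only [map_mul, map_add, ← hf₁, ← hf₂]
    ring
  · simp only [map_mul, map_add]
    field_simp

theorem HasValueAt.mul (h₁ : HasValueAt f₁ y z₁) (h₂ : HasValueAt f₂ y z₂) :
    HasValueAt (f₁ * f₂) y (z₁ * z₂) := by
  obtain ⟨p₁, q₁, hq₁, hf₁, rfl⟩ := h₁
  obtain ⟨p₂, q₂, hq₂, hf₂, rfl⟩ := h₂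
  refine ⟨p₁ * p₂, q₁ * q₂, by simp [hq₁, hq₂], ?_, ?_⟩
  · simp only [map_mul, ← hf₁, ← hf₂]
    ring
  · simp only [map_mul]
    field_simp

theorem HasValueAt.neg (h : HasValueAt f y z) : HasValueAt (-f) y (-z) := by
  obtain ⟨p, q, hq, hf, rfl⟩ := h
  exact ⟨-p, q, hq, by rw [map_neg, neg_mul, hf], by rw [map_neg, neg_div]⟩

theorem HasValueAt.sub (h₁ : HasValueAt f₁ y z₁) (h₂ : HasValueAt f₂ y z₂) :
    HasValueAt (f₁ - f₂) y (z₁ - z₂) := by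
  rw [sub_eq_add_neg, sub_eq_add_neg]
  exact h₁.add h₂.neg

theorem HasValueAt.inv (h : HasValueAt f y z) (hz : z ≠ 0) : HasValueAt f⁻¹ y z⁻¹ := by
  obtain ⟨p, q, hq, rfl, rfl⟩ := hasValueAt_iff_eq_div.mp h
  refine hasValueAt_iff_eq_div.mpr ⟨q, p, fun h0 => hz (by rw [h0, zero_div]), ?_, ?_⟩ <;>
  rw [inv_div]

theorem HasValueAt.div (h₁ : HasValueAt f₁ y z₁) (h₂ : HasValueAt f₂ y z₂) (hz : z₂ ≠ 0) :
    HasValueAt (f₁ / f₂) y (z₁ / z₂) := by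
  rw [div_eq_mul_inv, div_eq_mul_inv]
  exact h₁.mul (h₂.inv hz)

theorem HasValueAt.ne_zero (h : HasValueAt f y z) (hz : z ≠ 0) : f ≠ 0 := by
  rintro rfl
  exact hz (h.unique hasValueAt_zero)

theorem HasValueAt.aeval {Z : Entry i j k → RatField i j k F} {z : Entry i j k → L}
    (h : ∀ a, HasValueAt (Z a) y (z a)) (p : MvPolynomial (Entry i j k) F) :
    HasValueAt (MvPolynomial.aeval Z p) y (MvPolynomial.aeval z p) := by
  induction p using MvPolynomial.induction_on with
  | C a =>
    have := hasValueAt_algebraMap (y := y) (MvPolynomial.C (σ := Entry i j k) a)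
    rw [MvPolynomial.aeval_C] at this ⊢
    rw [MvPolynomial.aeval_C, IsScalarTower.algebraMap_apply F (MvPolynomial (Entry i j k) F)]
    exact this
  | add p q hp hq =>
    rw [map_add, map_add]
    exact hp.add hq
  | mul_X p a hp =>
    rw [map_mul, map_mul, MvPolynomial.aeval_X, MvPolynomial.aeval_X]
    exact hp.mul (h a)

end Value

/-! ### The multi-ratio map -/

section MultiRatio

variable {K : Type*} [Field K]

/-- The denominator of `multiRatioSol`. -/
def multiRatioDen (y0 y0n ym0 y00 ymn : K) : K :=
  (y0 - ym0) * (y0n - ymn) - (y0 - ymn) * (y00 - ym0)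

theorem multiRatioSol_eq_div (y0 y0n ym0 y00 ymn : K) : multiRatioSol y0 y0n ym0 y00 ymn =
    ((y0 - ym0) * (y0n - ymn) * y00 - (y0 - ymn) * (y00 - ym0) * y0n) /
      multiRatioDen y0 y0n ym0 y00 ymn := rfl

theorem multiRatioSol_eq_iff {y0 y0n ym0 y00 ymn z : K}
    (h : multiRatioDen y0 y0n ym0 y00 ymn ≠ 0) : multiRatioSol y0 y0n ym0 y00 ymn = z ↔
      (y0 - ym0) * (y0n - ymn) * (y00 - z) = (y0 - ymn) * (y00 - ym0) * (y0n - z) := by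
  rw [multiRatioSol_eq_div, div_eq_iff h]
  unfold multiRatioDen
  constructor <;> intro h <;> linear_combination h

/-- Symmetry under transposing the second array, which transfers the relations for `s` to those for
`t`. -/
theorem multiRatioSol_swap (y0 y0n ym0 y00 ymn : K) :
    multiRatioSol y0 y0n ym0 y00 ymn = multiRatioSol y0 ym0 y0n y00 ymn := by
  unfold multiRatioSol
  congr 1 <;> ring

/-- The equation is an involution condition on three pairs, so the two known pairs may be exchanged.
-/
theorem multiRatioSol_swap_pairs (y0 y0n ym0 y00 ymn : K) :
    multiRatioSol y0 y0n ym0 y00 ymn = multiRatioSol y0 y00 ymn y0n ym0 := by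
  unfold multiRatioSol
  rw [← neg_div_neg_eq]
  congr 1 <;> ring

/-- Differences from the solution factor completely over the denominator. After this substitution
the braid relations with `s` are visible to `ring`. -/
theorem sub_multiRatioSol {y0 y0n ym0 y00 ymn : K} (h : multiRatioDen y0 y0n ym0 y00 ymn ≠ 0) :
    y00 - multiRatioSol y0 y0n ym0 y00 ymn =
      (y0 - ymn) * (y00 - ym0) * (y0n - y00) / multiRatioDen y0 y0n ym0 y00 ymn := by
  rw [multiRatioSol_eq_div, eq_div_iff h, sub_mul, div_mul_cancel₀ _ h]
  unfold multiRatioDen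
  ring

theorem sub_multiRatioSol' {y0 y0n ym0 y00 ymn : K} (h : multiRatioDen y0 y0n ym0 y00 ymn ≠ 0) :
    y0n - multiRatioSol y0 y0n ym0 y00 ymn =
      (y0 - ym0) * (y0n - ymn) * (y0n - y00) / multiRatioDen y0 y0n ym0 y00 ymn := by
  rw [multiRatioSol_eq_div, eq_div_iff h, sub_mul, div_mul_cancel₀ _ h]
  unfold multiRatioDen
  ring

/-- The multi-ratio equation is invariant under exchanging `a` with `b` and, at the same time, `x`
with its solution. -/
theorem multiRatioSol_multiRatioSol {a b d p x : K} (h : multiRatioDen a d p b x ≠ 0)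
    (h' : multiRatioDen b d p a (multiRatioSol a d p b x) ≠ 0) :
    multiRatioSol b d p a (multiRatioSol a d p b x) = x := by
  have := (multiRatioSol_eq_iff h).mp rfl
  rw [multiRatioSol_eq_iff h']
  linear_combination -this

/-- With `z` the inner solution, the pairs `{d, p}`, `{b, x}`, `{a, z}` belong to one involution.
The partner of `a'` may be computed from `{d, p}` and either of the other two. -/
theorem multiRatioSol_braid_r {a a' b d p x : K} (h : multiRatioDen a d p b x ≠ 0)
    (h' : multiRatioDen a' d p b x ≠ 0)
    (h'' : multiRatioDen a' d p a (multiRatioSol a d p b x) ≠ 0) :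
    multiRatioSol a' d p a (multiRatioSol a d p b x) = multiRatioSol a' d p b x := by
  rw [multiRatioSol_eq_iff h'']
  have h1 := (multiRatioSol_eq_iff h).mp rfl
  have h2 := (multiRatioSol_eq_iff h').mp rfl
  generalize multiRatioSol a d p b x = z at *
  generalize multiRatioSol a' d p b x = w at *
  apply mul_left_cancel₀ h
  unfold multiRatioDen
  linear_combination (a * z - d * p - a * (a + z - d - p)) * h2 +
    (a * (a' + w - d - p) - (a' * w - d * p)) * h1

theorem multiRatioSol_braid_s {a b c d p q r : K} (h1 : multiRatioDen a c p b q ≠ 0)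
    (hn : multiRatioDen a d p b r ≠ 0) (hw : multiRatioDen a d q c r ≠ 0)
    (h : multiRatioDen b d (multiRatioSol a c p b q) c (multiRatioSol a d p b r) ≠ 0) :
    multiRatioSol b d (multiRatioSol a c p b q) c (multiRatioSol a d p b r) =
      multiRatioSol a d q c r := by
  rw [multiRatioSol_eq_iff h, sub_multiRatioSol h1, sub_multiRatioSol hn, sub_multiRatioSol hw,
    sub_multiRatioSol' h1, sub_multiRatioSol' hn, sub_multiRatioSol' hw]
  ring

theorem multiRatioSol_braid_s' {a b c p q : K} (h1 : multiRatioDen a c p b q ≠ 0)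
    (h : multiRatioDen b a (multiRatioSol a c p b q) c p ≠ 0) :
    multiRatioSol b a (multiRatioSol a c p b q) c p = q := by
  rw [multiRatioSol_eq_iff h, sub_multiRatioSol h1, sub_multiRatioSol' h1]
  ring

end MultiRatio

/-- The denominators of the birational actions do not vanish. -/
def ActRegular {K : Type*} [Field K] (y : Entry i j k → K) : Prop :=
  ∀ m n, m ≠ 0 → n ≠ 0 → multiRatioDen (y (.inl 0)) (y (.inr (0, n))) (y (.inr (m, 0)))
    (y (.inr (0, 0))) (y (.inr (m, n))) ≠ 0

section Act

variable {K : Type*} [Field K] (y : Entry i j k → K)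

theorem act_r_succ_inl (n : ℕ) (h : n + 1 < k + 1) (a : Fin (k + 1)) :
    act (.r ⟨n + 1, h⟩) y (.inl a) = y (.inl (adjSwap ⟨n, by omega⟩ a)) := rfl

theorem act_r_succ_inr (n : ℕ) (h : n + 1 < k + 1) (p : Fin (i + 1) × Fin (j + 1)) :
    act (.r ⟨n + 1, h⟩) y (.inr p) = y (.inr p) := rfl

theorem act_s_inl (n : Fin j) (a : Fin (k + 1)) : act (.s n) y (.inl a) = y (.inl a) := rfl

theorem act_s_inr (n : Fin j) (p : Fin (i + 1) × Fin (j + 1)) :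
    act (.s n) y (.inr p) = y (.inr (p.1, adjSwap n p.2)) := rfl

theorem act_t_inl (m : Fin i) (a : Fin (k + 1)) : act (.t m) y (.inl a) = y (.inl a) := rfl

theorem act_t_inr (m : Fin i) (p : Fin (i + 1) × Fin (j + 1)) :
    act (.t m) y (.inr p) = y (.inr (adjSwap m p.1, p.2)) := rfl

theorem act_r_zero_inl_zero : act (.r 0) y (.inl 0) = y (.inr (0, 0)) := rfl

theorem act_r_zero_inl {a : Fin (k + 1)} (h : a ≠ 0) : act (.r 0) y (.inl a) = y (.inl a) :=
  if_neg h

theorem act_r_zero_inr_zero : act (.r 0) y (.inr (0, 0)) = y (.inl 0) := rfl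

theorem act_r_zero_inr_fst {m : Fin (i + 1)} (h : m ≠ 0) :
    act (.r 0) y (.inr (m, 0)) = y (.inr (m, 0)) := by
  change (if ((m, 0) : Fin (i + 1) × Fin (j + 1)) = (0, 0) then _ else if _ then _ else _) = _
  rw [if_neg (by simp [h]), if_pos (.inr rfl)]

theorem act_r_zero_inr_snd {n : Fin (j + 1)} (h : n ≠ 0) :
    act (.r 0) y (.inr (0, n)) = y (.inr (0, n)) := by
  change (if ((0, n) : Fin (i + 1) × Fin (j + 1)) = (0, 0) then _ else if _ then _ else _) = _
  rw [if_neg (by simp [h]), if_pos (.inl rfl)]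

theorem act_r_zero_inr {m : Fin (i + 1)} {n : Fin (j + 1)} (hm : m ≠ 0) (hn : n ≠ 0) :
    act (.r 0) y (.inr (m, n)) = multiRatioSol (y (.inl 0)) (y (.inr (0, n))) (y (.inr (m, 0)))
      (y (.inr (0, 0))) (y (.inr (m, n))) := by
  change (if (m, n) = (0, 0) then _ else if _ then _ else _) = _
  rw [if_neg (by simp [hm]), if_neg (by simp [hm, hn])]

/-- An induction principle for the entries of the second array, adapted to the action of `r 0`. -/
theorem entry_cases {P : Entry i j k → Prop} (hl0 : P (.inl 0)) (hl : ∀ a ≠ 0, P (.inl a))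
    (h00 : P (.inr (0, 0))) (hm0 : ∀ m ≠ 0, P (.inr (m, 0))) (h0n : ∀ n ≠ 0, P (.inr (0, n)))
    (hmn : ∀ m n, m ≠ 0 → n ≠ 0 → P (.inr (m, n))) (e : Entry i j k) : P e := by
  rcases e with a | ⟨m, n⟩
  · by_cases h : a = 0
    · rwa [h]
    · exact hl a h
  · by_cases h : m = 0 <;> by_cases h' : n = 0
    · rwa [h, h']
    · rw [h]
      exact h0n n h'
    · rw [h']
      exact hm0 m h
    · exact hmn m n h h'

/-- The actions commute with field homomorphisms. -/
theorem map_act {K' : Type*} [Field K'] (φ : K →+* K') (g : Node i j k) (e : Entry i j k) :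
    φ (act g y e) = act g (φ ∘ y) e := by
  rcases g with ⟨_ | n, h⟩ | n | m
  · change φ (act (.r 0) y e) = act (.r 0) (φ ∘ y) e
    induction e using entry_cases with
    | hl0 => rfl
    | hl a h => rw [act_r_zero_inl _ h, act_r_zero_inl _ h]; rfl
    | h00 => rfl
    | hm0 m h => rw [act_r_zero_inr_fst _ h, act_r_zero_inr_fst _ h]; rfl
    | h0n n h => rw [act_r_zero_inr_snd _ h, act_r_zero_inr_snd _ h]; rfl
    | hmn m n hm hn =>
      rw [act_r_zero_inr _ hm hn, act_r_zero_inr _ hm hn]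
      simp [multiRatioSol]
  all_goals rcases e with a | p <;> rfl

theorem hasValueAt_act {F L : Type*} [Field F] [Field L] [Algebra F L] {y z : Entry i j k → L}
    {Z : Entry i j k → RatField i j k F} (h : ∀ a, HasValueAt (Z a) y (z a)) (hz : ActRegular z)
    (g : Node i j k) (e : Entry i j k) : HasValueAt (act g Z e) y (act g z e) := by
  rcases g with ⟨_ | n, _⟩ | n | m
  · change HasValueAt (act (.r 0) Z e) y (act (.r 0) z e)
    induction e using entry_cases with
    | hl0 => exact h _
    | hl a ha => rw [act_r_zero_inl _ ha, act_r_zero_inl _ ha]; exact h _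
    | h00 => exact h _
    | hm0 m hm => rw [act_r_zero_inr_fst _ hm, act_r_zero_inr_fst _ hm]; exact h _
    | h0n n hn => rw [act_r_zero_inr_snd _ hn, act_r_zero_inr_snd _ hn]; exact h _
    | hmn m n hm hn =>
      rw [act_r_zero_inr _ hm hn, act_r_zero_inr _ hm hn]
      refine HasValueAt.div ?_ ?_ (hz m n hm hn)
      · exact ((((h _).sub (h _)).mul ((h _).sub (h _))).mul (h _)).sub
          ((((h _).sub (h _)).mul ((h _).sub (h _))).mul (h _))
      · exact (((h _).sub (h _)).mul ((h _).sub (h _))).sub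
          (((h _).sub (h _)).mul ((h _).sub (h _)))
  all_goals rcases e with a | p <;> exact h _

/-- A denominator that is non-zero at a single specialisation is a non-zero rational function. -/
theorem actRegular_of_hasValueAt {F L : Type*} [Field F] [Field L] [Algebra F L]
    {y z : Entry i j k → L} {Z : Entry i j k → RatField i j k F}
    (h : ∀ a, HasValueAt (Z a) y (z a)) (hz : ActRegular z) : ActRegular Z := by
  intro m n hm hn
  refine HasValueAt.ne_zero (y := y) ?_ (hz m n hm hn)
  exact (((h _).sub (h _)).mul ((h _).sub (h _))).sub (((h _).sub (h _)).mul ((h _).sub (h _)))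

end Act

/-! ### Monomial points -/

section Monomial

variable (i j k : ℕ) (F : Type*) [Field F]

/-- The field of fractions of the group algebra of the lattice. -/
abbrev MonField : Type _ := FractionRing (AddMonoidAlgebra F (Lat i j k))

variable {i j k}

/-- A lattice vector as a monomial. -/
noncomputable def mono (x : Lat i j k) : MonField i j k F :=
  algebraMap (AddMonoidAlgebra F (Lat i j k)) _ (AddMonoidAlgebra.single x 1)

theorem mono_add (x x' : Lat i j k) : mono F (x + x') = mono F x * mono F x' := by
  rw [mono, mono, mono, ← map_mul, AddMonoidAlgebra.single_mul_single, one_mul]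

theorem mono_injective : Function.Injective (mono F : Lat i j k → MonField i j k F) := fun _ _ h =>
  AddMonoidAlgebra.of_injective (FaithfulSMul.algebraMap_injective _ _ h)

theorem mono_ne_zero (x : Lat i j k) : mono F x ≠ 0 := by
  rw [mono, ne_eq, FaithfulSMul.algebraMap_eq_zero_iff]
  simp

theorem mono_sub (x x' : Lat i j k) : mono F (x - x') = mono F x / mono F x' := by
  rw [eq_div_iff (mono_ne_zero F x'), ← mono_add, sub_add_cancel]

/-- The array of monomials of the image of the array vectors under a group element. -/
noncomputable def monoPoint (w : W i j k) (a : Entry i j k) : MonField i j k F :=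
  mono F (latRep i j k w (latVec a))

theorem monoPoint_injective (w : W i j k) : Function.Injective (monoPoint F w) := fun _ _ h =>
  latVec_injective (latRep_injective w (mono_injective F h))

theorem monoPoint_mul (w : W i j k) (m : Fin (i + 1)) (n : Fin (j + 1)) :
    monoPoint F w (.inr (0, 0)) * monoPoint F w (.inr (m, n)) =
      monoPoint F w (.inr (m, 0)) * monoPoint F w (.inr (0, n)) := by
  simp only [monoPoint, ← mono_add, ← map_add, latVec_add_latVec, crossSum]

/-- Where `y_00 y_mn = y_m0 y_0n`, the denominator times `y_00` equals `-y_0 (y_00 - y_m0) (y_00 -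
y_0n)`, and distinct lattice vectors give distinct monomials. -/
theorem actRegular_monoPoint (w : W i j k) : ActRegular (monoPoint F w) := by
  intro m n hm hn h0
  have h := monoPoint_mul F w m n
  have h1 : monoPoint F w (.inr (0, 0)) - monoPoint F w (.inr (m, 0)) ≠ 0 :=
    sub_ne_zero.mpr ((monoPoint_injective F w).ne (by simp [hm.symm]))
  have h2 : monoPoint F w (.inr (0, 0)) - monoPoint F w (.inr (0, n)) ≠ 0 :=
    sub_ne_zero.mpr ((monoPoint_injective F w).ne (by simp [hn.symm]))
  have h3 : monoPoint F w (.inl 0) ≠ 0 := mono_ne_zero F _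
  refine mul_ne_zero h3 (mul_ne_zero h1 h2) ?_
  unfold multiRatioDen at h0
  linear_combination -monoPoint F w (.inr (0, 0)) * h0 +
    (monoPoint F w (.inr (0, 0)) - monoPoint F w (.inl 0)) * h

/-- The birational action restricts to the linear one on monomials. For `r 0` the point is that
`y_m0 y_0n / y_0` solves the multi-ratio equation when `y_00 y_mn = y_m0 y_0n`. -/
theorem act_monoPoint (w : W i j k) (g : Node i j k) (e : Entry i j k) :
    act g (monoPoint F w) e = monoPoint F (w * gen g) e := by
  rw [monoPoint, latRep_mul_apply]
  rcases g with ⟨_ | n, h⟩ | n | m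
  · change act (.r 0) (monoPoint F w) e = mono F (latRep i j k w (latRep i j k (gen (.r 0)) _))
    induction e using entry_cases with
    | hl0 => rw [latRep_r_zero_inl_zero]; rfl
    | hl a ha => rw [latRep_r_zero_inl ha, act_r_zero_inl _ ha]; rfl
    | h00 => rw [latRep_r_zero_inr_zero]; rfl
    | hm0 m hm =>
      rw [latRep_r_zero_inr (by simp [hm]) (.inr rfl), act_r_zero_inr_fst _ hm]; rfl
    | h0n n hn =>
      rw [latRep_r_zero_inr (by simp [hn]) (.inl rfl), act_r_zero_inr_snd _ hn]; rfl
    | hmn m n hm hn =>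
      rw [latRep_r_zero_inr_of_ne hm hn, act_r_zero_inr _ hm hn,
        multiRatioSol_eq_iff (actRegular_monoPoint F w m n hm hn), map_sub, map_add, mono_sub,
        mono_add]
      change _ * _ * (_ - monoPoint F w (.inr (m, 0)) * monoPoint F w (.inr (0, n)) /
        monoPoint F w (.inl 0)) = _ * _ * (_ - monoPoint F w (.inr (m, 0)) *
          monoPoint F w (.inr (0, n)) / monoPoint F w (.inl 0))
      have h := monoPoint_mul F w m n
      have h3 : monoPoint F w (.inl 0) ≠ 0 := mono_ne_zero F _
      generalize monoPoint F w (.inl 0) = A at *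
      generalize monoPoint F w (.inr (0, 0)) = B at *
      generalize monoPoint F w (.inr (m, 0)) = p at *
      generalize monoPoint F w (.inr (0, n)) = d at *
      generalize monoPoint F w (.inr (m, n)) = x at *
      apply mul_left_cancel₀ h3
      linear_combination -(A - p) * (A - d) * h +
        ((A - x) * (B - p) - (A - p) * (d - x)) * mul_div_cancel₀ (p * d) h3
  · rcases e with a | p
    · rw [latRep_r_succ_inl]; rfl
    · rw [latRep_r_succ_inr]; rfl
  · rcases e with a | p
    · rw [latRep_s_inl]; rfl
    · rw [latRep_s_inr]; rfl
  · rcases e with a | p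
    · rw [latRep_t_inl]; rfl
    · rw [latRep_t_inr]; rfl

end Monomial

/-! ### Transpositions of consecutive indices. -/

section Swap

variable {N : ℕ}

theorem adjSwap_zero {n : Fin N} (h : n.val ≠ 0) : adjSwap n 0 = 0 := by
  refine Equiv.swap_apply_of_ne_of_ne ?_ ?_ <;> simp [Fin.ext_iff, eq_comm, h]

theorem adjSwap_ne_zero {n : Fin N} (h : n.val ≠ 0) {a : Fin (N + 1)} (ha : a ≠ 0) :
    adjSwap n a ≠ 0 := fun h0 => ha (by
  rw [← adjSwap_adjSwap n a, h0, adjSwap_zero h])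

theorem adjSwap_comm {m n : Fin N} (h : m.val + 1 ≠ n.val) (h' : n.val + 1 ≠ m.val)
    (a : Fin (N + 1)) : adjSwap m (adjSwap n a) = adjSwap n (adjSwap m a) := by
  simp only [adjSwap, Equiv.swap_apply_def, Fin.ext_iff, apply_ite Fin.val, Fin.val_castSucc,
    Fin.val_succ]
  split_ifs <;> omega

theorem adjSwap_braid {m n : Fin N} (h : m.val + 1 = n.val) (a : Fin (N + 1)) :
    adjSwap m (adjSwap n (adjSwap m a)) = adjSwap n (adjSwap m (adjSwap n a)) := by
  have h0 : n.castSucc = m.succ := by ext; simp [h]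
  have h1 : m.castSucc ≠ m.succ := by simp [Fin.ext_iff]
  have h2 : n.succ ≠ m.succ := by simp [Fin.ext_iff]; omega
  have h3 : m.castSucc ≠ n.succ := by simp [Fin.ext_iff]; omega
  have e1 := Equiv.swap_mul_swap_mul_swap h1 h3
  have e2 := Equiv.swap_mul_swap_mul_swap h2 h3.symm
  rw [Equiv.swap_comm n.succ m.succ, Equiv.swap_comm m.succ m.castSucc,
    Equiv.swap_comm m.castSucc n.succ, ← e1] at e2
  rw [adjSwap, adjSwap, h0]
  exact congrArg (fun σ : Equiv.Perm _ => σ a) e2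

theorem adjSwap_braid' {m n : Fin N} (h : m.val + 1 = n.val ∨ n.val + 1 = m.val)
    (a : Fin (N + 1)) :
    adjSwap m (adjSwap n (adjSwap m a)) = adjSwap n (adjSwap m (adjSwap n a)) := by
  rcases h with h | h
  · exact adjSwap_braid h a
  · exact (adjSwap_braid h a).symm

theorem exists_adjSwap_zero {n : Fin N} (h : n.val = 0) : ∃ o : Fin (N + 1), o ≠ 0 ∧
    adjSwap n 0 = o ∧ adjSwap n o = 0 ∧ ∀ a, a ≠ 0 → a ≠ o → adjSwap n a = a := by
  have h0 : (0 : Fin (N + 1)) = n.castSucc := by ext; simp [h]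
  refine ⟨n.succ, by simp [Fin.ext_iff], ?_, ?_, fun a h1 h2 => ?_⟩
  · rw [h0, adjSwap, Equiv.swap_apply_left]
  · rw [h0, adjSwap, Equiv.swap_apply_right]
  · exact Equiv.swap_apply_of_ne_of_ne (by rwa [← h0]) h2

end Swap

theorem multiRatioDen_swap {K : Type*} [Field K] (y0 y0n ym0 y00 ymn : K) :
    multiRatioDen y0 y0n ym0 y00 ymn = multiRatioDen y0 ym0 y0n y00 ymn := by
  unfold multiRatioDen
  ring

/-! ### Relations between the actions -/

section Relations

variable {K : Type*} [Field K] {y : Entry i j k → K}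

theorem act_act_self {g : Node i j k} (h : ActRegular y) (h' : ActRegular (act g y)) :
    act g (act g y) = y := by
  ext e
  rcases g with ⟨_ | n, hn⟩ | n | m
  · change ActRegular (act (.r 0) y) at h'
    change act (.r 0) (act (.r 0) y) e = y e
    induction e using entry_cases with
    | hl0 => rfl
    | hl a h => rw [act_r_zero_inl _ h, act_r_zero_inl _ h]
    | h00 => rfl
    | hm0 m h => rw [act_r_zero_inr_fst _ h, act_r_zero_inr_fst _ h]
    | h0n n h => rw [act_r_zero_inr_snd _ h, act_r_zero_inr_snd _ h]
    | hmn m n hm hn =>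
      have h2 := h' m n hm hn
      rw [act_r_zero_inr _ hm hn]
      simp only [act_r_zero_inr_fst _ hm, act_r_zero_inr_snd _ hn, act_r_zero_inl_zero,
        act_r_zero_inr_zero, act_r_zero_inr _ hm hn] at h2 ⊢
      exact multiRatioSol_multiRatioSol (h m n hm hn) h2
  all_goals rcases e with a | p
  · simp only [act_r_succ_inl, adjSwap_adjSwap]
  · rfl
  · rfl
  · simp only [act_s_inr, adjSwap_adjSwap]
  · rfl
  · simp only [act_t_inr, adjSwap_adjSwap]

theorem act_r_zero_comm_r {n : ℕ} (h : n + 1 < k + 1) (hn : n ≠ 0) :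
    act (.r 0) (act (.r ⟨n + 1, h⟩) y) = act (.r ⟨n + 1, h⟩) (act (.r 0) y) := by
  have h0 : adjSwap (⟨n, by omega⟩ : Fin k) 0 = 0 := adjSwap_zero hn
  ext e
  induction e using entry_cases with
  | hl0 => rw [act_r_succ_inl, h0]; rfl
  | hl a ha =>
    rw [act_r_zero_inl _ ha, act_r_succ_inl, act_r_succ_inl, act_r_zero_inl]
    exact adjSwap_ne_zero hn ha
  | h00 => rw [act_r_zero_inr_zero, act_r_succ_inl, h0]; rfl
  | hm0 m hm => simp only [act_r_zero_inr_fst _ hm, act_r_succ_inr]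
  | h0n n hn => simp only [act_r_zero_inr_snd _ hn, act_r_succ_inr]
  | hmn m n hm hn => simp only [act_r_zero_inr _ hm hn, act_r_succ_inr, act_r_succ_inl, h0]

theorem act_r_zero_comm_s {n : Fin j} (hn : n.val ≠ 0) :
    act (.r 0) (act (.s n) y) = act (.s n) (act (.r 0) y : Entry i j k → K) := by
  have h0 : adjSwap n 0 = 0 := adjSwap_zero hn
  ext e
  induction e using entry_cases with
  | hl0 => rw [act_r_zero_inl_zero, act_s_inr, h0]; rfl
  | hl a ha => simp only [act_r_zero_inl _ ha, act_s_inl]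
  | h00 => rw [act_s_inr, h0]; rfl
  | hm0 m hm => simp only [act_r_zero_inr_fst _ hm, act_s_inr, h0]
  | h0n l hl =>
    have hl' := adjSwap_ne_zero hn hl
    simp only [act_r_zero_inr_snd _ hl, act_r_zero_inr_snd _ hl', act_s_inr]
  | hmn m l hm hl =>
    have hl' := adjSwap_ne_zero hn hl
    simp only [act_r_zero_inr _ hm hl, act_r_zero_inr _ hm hl', act_s_inr, act_s_inl, h0]

theorem act_r_zero_comm_t {m : Fin i} (hm : m.val ≠ 0) :
    act (.r 0) (act (.t m) y) = act (.t m) (act (.r 0) y : Entry i j k → K) := by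
  have h0 : adjSwap m 0 = 0 := adjSwap_zero hm
  ext e
  induction e using entry_cases with
  | hl0 => rw [act_r_zero_inl_zero, act_t_inr, h0]; rfl
  | hl a ha => simp only [act_r_zero_inl _ ha, act_t_inl]
  | h00 => rw [act_t_inr, h0]; rfl
  | h0n n hn => simp only [act_r_zero_inr_snd _ hn, act_t_inr, h0]
  | hm0 l hl =>
    have hl' := adjSwap_ne_zero hm hl
    simp only [act_r_zero_inr_fst _ hl, act_r_zero_inr_fst _ hl', act_t_inr]
  | hmn l n hl hn =>
    have hl' := adjSwap_ne_zero hm hl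
    simp only [act_r_zero_inr _ hl hn, act_r_zero_inr _ hl' hn, act_t_inr, act_t_inl, h0]

/-- Only entries with `m, n ≠ 0` are more than a permutation; there the relation says that one
involution is determined by different pairs. -/
theorem act_r_zero_braid_r {h : 0 + 1 < k + 1} (h0 : ActRegular y)
    (h1 : ActRegular (act (.r ⟨0 + 1, h⟩) y))
    (h2 : ActRegular (act (.r ⟨0 + 1, h⟩) (act (.r 0) y))) :
    act (.r 0) (act (.r ⟨0 + 1, h⟩) (act (.r 0) y)) =
      act (.r ⟨0 + 1, h⟩) (act (.r 0) (act (.r ⟨0 + 1, h⟩) y)) := by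
  obtain ⟨o, ho, s0, so, s⟩ := exists_adjSwap_zero (n := (⟨0, by omega⟩ : Fin k)) rfl
  ext e
  induction e using entry_cases with
  | hl0 =>
    simp only [act_r_zero_inl_zero, act_r_succ_inl, act_r_succ_inr, s0, act_r_zero_inl _ ho, so,
      act_r_zero_inr_zero]
  | hl a ha =>
    by_cases hao : a = o
    · rw [hao]
      simp only [act_r_zero_inl_zero, act_r_succ_inl, act_r_succ_inr, so, act_r_zero_inl _ ho]
    · simp only [act_r_zero_inl _ ha, act_r_succ_inl, s a ha hao]
  | h00 =>
    simp only [act_r_zero_inr_zero, act_r_succ_inl, act_r_succ_inr, s0, act_r_zero_inl _ ho]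
  | hm0 m hm => simp only [act_r_zero_inr_fst _ hm, act_r_succ_inr]
  | h0n n hn => simp only [act_r_zero_inr_snd _ hn, act_r_succ_inr]
  | hmn m n hm hn =>
    have e0 := h0 m n hm hn
    have e1 := h1 m n hm hn
    have e2 := h2 m n hm hn
    simp only [act_r_zero_inr _ hm hn, act_r_succ_inl, act_r_succ_inr, s0, act_r_zero_inl _ ho,
      act_r_zero_inr_fst _ hm, act_r_zero_inr_snd _ hn, act_r_zero_inr_zero] at e1 e2 ⊢
    exact multiRatioSol_braid_r e0 e1 e2

/-- With `o` the index 1, entries `(m, 0)` need the exchange of pairs, entries `(m, o)` a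
cancellation of two solutions, and the remaining `(m, n)` the consistency identity
`multiRatioSol_braid_s`. -/
theorem act_r_zero_braid_s {q : Fin j} (hq : q.val = 0) (h0 : ActRegular y)
    (h1 : ActRegular (act (.s q) y)) (h2 : ActRegular (act (.s q) (act (.r 0) y))) :
    act (.r 0) (act (.s q) (act (.r 0) y)) =
      act (.s q) (act (.r 0) (act (.s q) y : Entry i j k → K)) := by
  obtain ⟨o, ho, s0, so, s⟩ := exists_adjSwap_zero hq
  ext e
  induction e using entry_cases with
  | hl0 =>
    simp only [act_r_zero_inl_zero, act_s_inl, act_s_inr, s0, act_r_zero_inr_snd _ ho]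
  | hl a ha => simp only [act_r_zero_inl _ ha, act_s_inl]
  | h00 =>
    simp only [act_r_zero_inr_zero, act_r_zero_inl_zero, act_s_inl, act_s_inr, s0,
      act_r_zero_inr_snd _ ho, so]
  | hm0 m hm =>
    simp only [act_r_zero_inr_fst _ hm, act_s_inl, act_s_inr, s0, so, act_r_zero_inr _ hm ho]
    exact multiRatioSol_swap_pairs _ _ _ _ _
  | h0n n hn =>
    by_cases hno : n = o
    · rw [hno]
      simp only [act_r_zero_inr_zero, act_r_zero_inr_snd _ ho, act_s_inl, act_s_inr, so]
    · simp only [act_r_zero_inr_snd _ hn, act_s_inr, s n hn hno]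
  | hmn m n hm hn =>
    have e0 := h0 m o hm ho
    have e1 := h0 m n hm hn
    have e2 := h1 m n hm hn
    have e3 := h2 m n hm hn
    by_cases hno : n = o
    · rw [hno] at e3 ⊢
      simp only [act_r_zero_inl_zero, act_r_zero_inr_zero, act_r_zero_inr_snd _ ho,
        act_r_zero_inr_fst _ hm, act_s_inl, act_s_inr, s0, so, act_r_zero_inr _ hm ho] at e3 ⊢
      exact multiRatioSol_braid_s' e0 e3
    · simp only [act_r_zero_inl_zero, act_r_zero_inr_snd _ ho,
        act_r_zero_inr_snd _ hn, act_s_inl, act_s_inr, s0, s n hn hno,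
        act_r_zero_inr _ hm ho, act_r_zero_inr _ hm hn] at e2 e3 ⊢
      exact multiRatioSol_braid_s e0 e1 e2 e3

/-- The transpose of the relation for `s`; the rewrites by `multiRatioSol_swap` bring each solution
into transposed form. -/
theorem act_r_zero_braid_t {q : Fin i} (hq : q.val = 0) (h0 : ActRegular y)
    (h1 : ActRegular (act (.t q) y)) (h2 : ActRegular (act (.t q) (act (.r 0) y))) :
    act (.r 0) (act (.t q) (act (.r 0) y)) =
      act (.t q) (act (.r 0) (act (.t q) y : Entry i j k → K)) := by
  obtain ⟨o, ho, s0, so, s⟩ := exists_adjSwap_zero hq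
  ext e
  induction e using entry_cases with
  | hl0 =>
    simp only [act_r_zero_inl_zero, act_t_inl, act_t_inr, s0, act_r_zero_inr_fst _ ho]
  | hl a ha => simp only [act_r_zero_inl _ ha, act_t_inl]
  | h00 =>
    simp only [act_r_zero_inr_zero, act_r_zero_inl_zero, act_t_inl, act_t_inr, s0,
      act_r_zero_inr_fst _ ho, so]
  | h0n n hn =>
    simp only [act_r_zero_inr_snd _ hn, act_t_inl, act_t_inr, s0, so, act_r_zero_inr _ ho hn]
    rw [multiRatioSol_swap, multiRatioSol_swap_pairs, multiRatioSol_swap]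
  | hm0 m hm =>
    by_cases hmo : m = o
    · rw [hmo]
      simp only [act_r_zero_inr_zero, act_r_zero_inr_fst _ ho, act_t_inl, act_t_inr, so]
    · simp only [act_r_zero_inr_fst _ hm, act_t_inr, s m hm hmo]
  | hmn m n hm hn =>
    have e0 := h0 o n ho hn
    have e1 := h0 m n hm hn
    have e2 := h1 m n hm hn
    have e3 := h2 m n hm hn
    rw [multiRatioDen_swap] at e0 e1 e2 e3
    by_cases hmo : m = o
    · rw [hmo] at e3 ⊢
      simp only [act_r_zero_inl_zero, act_r_zero_inr_zero, act_r_zero_inr_snd _ hn,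
        act_r_zero_inr_fst _ ho, act_t_inl, act_t_inr, s0, so, act_r_zero_inr _ ho hn] at e3 ⊢
      rw [multiRatioSol_swap (y (.inl 0))] at e3 ⊢
      rw [multiRatioSol_swap]
      exact multiRatioSol_braid_s' e0 e3
    · simp only [act_r_zero_inl_zero, act_r_zero_inr_fst _ ho,
        act_r_zero_inr_fst _ hm, act_t_inl, act_t_inr, s0, s m hm hmo,
        act_r_zero_inr _ ho hn, act_r_zero_inr _ hm hn] at e2 e3 ⊢
      rw [multiRatioSol_swap (y (.inl 0)), multiRatioSol_swap (y (.inl 0)) _ _ _ (y (.inr (m, n)))]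
        at e3
      rw [multiRatioSol_swap, multiRatioSol_swap (y (.inl 0)) (y (.inr (0, n))),
        multiRatioSol_swap (y (.inl 0)) (y (.inr (0, n))),
        multiRatioSol_swap (y (.inl 0)) (y (.inr (o, n)))]
      exact multiRatioSol_braid_s e0 e1 e2 e3

end Relations

/-! ### The representation by birational actions -/

section Representation

variable {F : Type*} [Field F]

/-- Arrays of rational functions that specialise to monomials. -/
def IsSpecial (Z : Entry i j k → RatField i j k F) : Prop :=
  ∃ w : W i j k, ∀ a, HasValueAt (Z a) (monoPoint F 1) (monoPoint F w a)

variable {Z : Entry i j k → RatField i j k F}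

theorem isSpecial_indet : IsSpecial (indet i j k F) := ⟨1, fun a => hasValueAt_indet a⟩

theorem IsSpecial.act (h : IsSpecial Z) (g : Node i j k) : IsSpecial (act g Z) := by
  obtain ⟨w, hw⟩ := h
  refine ⟨w * gen g, fun a => ?_⟩
  rw [← act_monoPoint]
  exact hasValueAt_act hw (actRegular_monoPoint F w) g a

theorem IsSpecial.actRegular (h : IsSpecial Z) : ActRegular Z := by
  obtain ⟨w, hw⟩ := h
  exact actRegular_of_hasValueAt hw (actRegular_monoPoint F w)

theorem IsSpecial.act_act_self (h : IsSpecial Z) (g : Node i j k) :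
    GossetElte.act g (GossetElte.act g Z) = Z :=
  GossetElte.act_act_self h.actRegular (h.act g).actRegular

theorem act_comm_of_not_linked {K : Type*} [Field K] {y : Entry i j k → K} {g h : Node i j k}
    (hne : g ≠ h) (hl : ¬ g.Linked h) : act g (act h y) = act h (act g y) := by
  rcases g with ⟨_ | n, hn⟩ | n | n <;> rcases h with ⟨_ | m, hm⟩ | m | m
  · exact absurd rfl hne
  · exact act_r_zero_comm_r hm (fun h0 => hl (.inl (by simp [h0])))
  · exact act_r_zero_comm_s (fun h0 => hl ⟨rfl, h0⟩)
  · exact act_r_zero_comm_t (fun h0 => hl ⟨rfl, h0⟩)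
  · exact (act_r_zero_comm_r hn (fun h0 => hl (.inr (by simp [h0])))).symm
  · ext (a | p)
    · simp only [act_r_succ_inl]
      simp only [Node.Linked] at hl
      rw [adjSwap_comm] <;> simp only <;> omega
    · rfl
  · ext (a | p) <;> rfl
  · ext (a | p) <;> rfl
  · exact (act_r_zero_comm_s (fun h0 => hl ⟨rfl, h0⟩)).symm
  · ext (a | p) <;> rfl
  · ext (a | p)
    · rfl
    · simp only [act_s_inr]
      simp only [Node.Linked] at hl
      rw [adjSwap_comm] <;> omega
  · ext (a | p) <;> rfl
  · exact (act_r_zero_comm_t (fun h0 => hl ⟨rfl, h0⟩)).symm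
  · ext (a | p) <;> rfl
  · ext (a | p) <;> rfl
  · ext (a | p)
    · rfl
    · simp only [act_t_inr]
      simp only [Node.Linked] at hl
      rw [adjSwap_comm] <;> omega

theorem IsSpecial.act_braid (hZ : IsSpecial Z) {g h : Node i j k} (hl : g.Linked h) :
    GossetElte.act g (GossetElte.act h (GossetElte.act g Z)) =
      GossetElte.act h (GossetElte.act g (GossetElte.act h Z)) := by
  have h0 := hZ.actRegular
  have h1 := fun g => (hZ.act g).actRegular
  have h2 := fun g h => ((hZ.act h).act g).actRegular
  rcases g with ⟨_ | n, hn⟩ | n | n <;> rcases h with ⟨_ | m, hm⟩ | m | m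
  · simp [Node.Linked] at hl
  · simp only [Node.Linked] at hl
    obtain rfl : m = 0 := by omega
    exact act_r_zero_braid_r h0 (h1 _) (h2 _ _)
  · exact act_r_zero_braid_s hl.2 h0 (h1 _) (h2 _ _)
  · exact act_r_zero_braid_t hl.2 h0 (h1 _) (h2 _ _)
  · simp only [Node.Linked] at hl
    obtain rfl : n = 0 := by omega
    exact (act_r_zero_braid_r h0 (h1 _) (h2 _ _)).symm
  · ext (a | p)
    · simp only [Node.Linked] at hl
      simp only [act_r_succ_inl]
      rw [adjSwap_braid']
      simp only
      omega
    · rfl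
  · simp [Node.Linked] at hl
  · simp [Node.Linked] at hl
  · exact (act_r_zero_braid_s hl.2 h0 (h1 _) (h2 _ _)).symm
  · simp [Node.Linked] at hl
  · ext (a | p)
    · rfl
    · simp only [Node.Linked] at hl
      simp only [act_s_inr]
      rw [adjSwap_braid' hl.symm]
  · simp [Node.Linked] at hl
  · exact (act_r_zero_braid_t hl.2 h0 (h1 _) (h2 _ _)).symm
  · simp [Node.Linked] at hl
  · simp [Node.Linked] at hl
  · ext (a | p)
    · rfl
    · simp only [Node.Linked] at hl
      simp only [act_t_inr]
      rw [adjSwap_braid' hl.symm]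

/-- Substituting the action a second time recovers the indeterminates, so a polynomial killed by the
first substitution is zero. -/
theorem aeval_act_injective (g : Node i j k) :
    Function.Injective (MvPolynomial.aeval (R := F) (act g (indet i j k F))) := by
  rw [injective_iff_map_eq_zero]
  intro p hp
  have h := HasValueAt.aeval (y := act g (indet i j k F)) (z := indet i j k F)
    (fun a => by
      have := hasValueAt_act (fun a => hasValueAt_indet (F := F) (y := act g (indet i j k F)) a)
        (isSpecial_indet.act g).actRegular g a
      rwa [isSpecial_indet.act_act_self] at this) p
  rw [hp] at h
  have h0 := h.unique hasValueAt_zero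
  have : MvPolynomial.aeval (indet i j k F) p = algebraMap _ (RatField i j k F) p := by
    have := MvPolynomial.aeval_algebraMap_apply (RatField i j k F)
      (MvPolynomial.X : Entry i j k → MvPolynomial (Entry i j k) F) p
    rwa [MvPolynomial.aeval_X_left_apply] at this
  rw [this, FaithfulSMul.algebraMap_eq_zero_iff] at h0
  exact h0

/-- The field endomorphism defined by the action of a generator. -/
noncomputable def actHom (F : Type*) [Field F] (g : Node i j k) :
    RatField i j k F →ₐ[F] RatField i j k F :=
  IsFractionRing.liftAlgHom (aeval_act_injective g)

theorem actHom_algebraMap (g : Node i j k) (p : MvPolynomial (Entry i j k) F) :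
    actHom F g (algebraMap _ _ p) = MvPolynomial.aeval (act g (indet i j k F)) p := by
  rw [actHom, IsFractionRing.liftAlgHom_apply, IsFractionRing.lift_algebraMap]
  rfl

theorem actHom_indet (g : Node i j k) (a : Entry i j k) :
    actHom F g (indet i j k F a) = act g (indet i j k F) a := by
  rw [indet, actHom_algebraMap, MvPolynomial.aeval_X]

theorem ratField_hom_ext {φ ψ : RatField i j k F →ₐ[F] RatField i j k F}
    (h : ∀ a, φ (indet i j k F a) = ψ (indet i j k F a)) : φ = ψ := by
  have h' : (φ.comp (Algebra.algHom F (MvPolynomial (Entry i j k) F) (RatField i j k F))) =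
      ψ.comp (Algebra.algHom F (MvPolynomial (Entry i j k) F) (RatField i j k F)) :=
    MvPolynomial.algHom_ext h
  apply AlgHom.coe_ringHom_injective
  apply IsFractionRing.injective_comp_algebraMap (A := MvPolynomial (Entry i j k) F)
  exact RingHom.ext fun p => AlgHom.congr_fun h' p

/-- Field maps act by substitution, so composition reverses the order of the actions on arrays. The
involution, commutation and braid relations are unaffected by this reversal. -/
theorem actHom_actHom_indet (g h : Node i j k) (a : Entry i j k) :
    actHom F g (actHom F h (indet i j k F a)) = act h (act g (indet i j k F)) a := by
  rw [actHom_indet]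
  have := map_act (indet i j k F) (actHom F g).toRingHom h a
  rw [AlgHom.toRingHom_eq_coe, RingHom.coe_coe] at this
  rw [this]
  congr 1
  ext b
  exact actHom_indet g b

theorem actHom_actHom_actHom_indet (g h l : Node i j k) (a : Entry i j k) :
    actHom F g (actHom F h (actHom F l (indet i j k F a))) =
      act l (act h (act g (indet i j k F))) a := by
  rw [actHom_indet]
  have := map_act (indet i j k F) ((actHom F g).comp (actHom F h)).toRingHom l a
  rw [AlgHom.toRingHom_eq_coe, RingHom.coe_coe] at this
  rw [← AlgHom.comp_apply, this]
  congr 1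
  ext b
  exact actHom_actHom_indet g h b

theorem actHom_comp_self (g : Node i j k) : (actHom F g).comp (actHom F g) = AlgHom.id F _ := by
  apply ratField_hom_ext
  intro a
  rw [AlgHom.comp_apply, actHom_actHom_indet, isSpecial_indet.act_act_self, AlgHom.id_apply]

/-- The field automorphism defined by the action of a generator. -/
noncomputable def actEquiv (F : Type*) [Field F] (g : Node i j k) :
    RatField i j k F ≃ₐ[F] RatField i j k F :=
  AlgEquiv.ofAlgHom (actHom F g) (actHom F g) (actHom_comp_self g) (actHom_comp_self g)

theorem actEquiv_apply (g : Node i j k) (f : RatField i j k F) : actEquiv F g f = actHom F g f :=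
  rfl

theorem ratField_equiv_ext {φ ψ : RatField i j k F ≃ₐ[F] RatField i j k F}
    (h : ∀ a, φ (indet i j k F a) = ψ (indet i j k F a)) : φ = ψ := by
  have := ratField_hom_ext (φ := φ.toAlgHom) (ψ := ψ.toAlgHom) h
  ext x
  exact congrArg (fun χ : RatField i j k F →ₐ[F] RatField i j k F => χ x) this

theorem actEquiv_mul_self (g : Node i j k) : actEquiv F g * actEquiv F g = 1 := by
  apply ratField_equiv_ext
  intro a
  rw [AlgEquiv.mul_apply, actEquiv_apply, actEquiv_apply, actHom_actHom_indet,
    isSpecial_indet.act_act_self]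
  rfl

theorem isLiftable_actEquiv : (coxeterMatrix i j k).IsLiftable (actEquiv F) := by
  intro g h
  by_cases hgh : g = h
  · rw [hgh, (coxeterMatrix i j k).diagonal, pow_one, actEquiv_mul_self]
  by_cases hl : g.Linked h
  · have hM : coxeterMatrix i j k g h = 3 := by
      simp [coxeterMatrix, hgh, hl]
    have hb : actEquiv F g * actEquiv F h * actEquiv F g =
        actEquiv F h * actEquiv F g * actEquiv F h := by
      apply ratField_equiv_ext
      intro a
      simp only [AlgEquiv.mul_apply, actEquiv_apply, actHom_actHom_actHom_indet]
      rw [isSpecial_indet.act_braid hl]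
    rw [hM]
    calc (actEquiv F g * actEquiv F h) ^ 3 = (actEquiv F g * actEquiv F h * actEquiv F g) *
          (actEquiv F h * actEquiv F g * actEquiv F h) := by
            simp only [pow_succ, pow_zero, one_mul, mul_assoc]
      _ = actEquiv F h * actEquiv F g * (actEquiv F h * actEquiv F h) *
          actEquiv F g * actEquiv F h := by
            rw [hb]
            simp only [mul_assoc]
      _ = 1 := by
        rw [actEquiv_mul_self, mul_one, mul_assoc (actEquiv F h), actEquiv_mul_self, mul_one,
          actEquiv_mul_self]
  · have hM : coxeterMatrix i j k g h = 2 := by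
      simp [coxeterMatrix, hgh, hl]
    have hb : actEquiv F g * actEquiv F h = actEquiv F h * actEquiv F g := by
      apply ratField_equiv_ext
      intro a
      simp only [AlgEquiv.mul_apply, actEquiv_apply, actHom_actHom_indet]
      rw [act_comm_of_not_linked hgh hl]
    rw [hM, pow_two]
    nth_rw 1 [hb]
    rw [mul_assoc, ← mul_assoc (actEquiv F g), actEquiv_mul_self, one_mul, actEquiv_mul_self]

/-- The representation of `W i j k` on the field of rational functions. -/
noncomputable def birational (i j k : ℕ) (F : Type*) [Field F] :
    W i j k →* (RatField i j k F ≃ₐ[F] RatField i j k F) :=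
  (coxeterMatrix i j k).toCoxeterSystem.lift ⟨_, isLiftable_actEquiv⟩

theorem birational_gen (g : Node i j k) : birational i j k F (gen g) = actEquiv F g := by
  have := (coxeterMatrix i j k).toCoxeterSystem.lift_apply_simple
    (isLiftable_actEquiv (F := F)) g
  rwa [CoxeterMatrix.toCoxeterSystem_simple] at this

theorem birational_gen_indet (g : Node i j k) (a : Entry i j k) :
    birational i j k F (gen g) (indet i j k F a) = act g (indet i j k F) a := by
  rw [birational_gen, actEquiv_apply, actHom_indet]

theorem birational_mul_apply (v w : W i j k) (f : RatField i j k F) :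
    birational i j k F (v * w) f = birational i j k F v (birational i j k F w f) := by
  rw [map_mul, AlgEquiv.mul_apply]

/-- `actHom F g` is precomposition with the action of `g`: evaluating the transformed function at
`y` is evaluating the original at `act g y`. -/
theorem hasValueAt_actHom {L : Type*} [Field L] [Algebra F L] {y : Entry i j k → L}
    (hy : ActRegular y) (g : Node i j k) {f : RatField i j k F} {z : L}
    (h : HasValueAt f (act g y) z) : HasValueAt (actHom F g f) y z := by
  obtain ⟨p, q, hq, rfl, rfl⟩ := hasValueAt_iff_eq_div.mp h
  rw [map_div₀, actHom_algebraMap, actHom_algebraMap]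
  have h := hasValueAt_act (fun a => hasValueAt_indet (F := F) (y := y) a) hy g
  exact (HasValueAt.aeval h p).div (HasValueAt.aeval h q) hq

theorem hasValueAt_birational_monoPoint (w u : W i j k) (e : Entry i j k) :
    HasValueAt (birational i j k F w (indet i j k F e)) (monoPoint F u)
      (monoPoint F (u * w) e) := by
  induction w using (coxeterMatrix i j k).toCoxeterSystem.simple_induction_left generalizing u with
  | one =>
    rw [map_one, mul_one]
    exact hasValueAt_indet e
  | mul_simple_left w g ih =>
    rw [CoxeterMatrix.toCoxeterSystem_simple]
    change HasValueAt (birational i j k F (gen g * w) _) _ (monoPoint F (u * (gen g * w)) e)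
    rw [birational_mul_apply, birational_gen, actEquiv_apply]
    apply hasValueAt_actHom (actRegular_monoPoint F u)
    have := ih (u * gen g)
    rwa [mul_assoc, ← show act g (monoPoint F u) = monoPoint F (u * gen g) from
      funext (act_monoPoint F u g)] at this

end Representation

/-! ### The rational function of a vertex -/

section VertexFun

variable {F : Type*} [Field F]

/-- Every generator except the ringed one leaves `y_k` alone. This makes the rational function of a
coset well defined. -/
theorem birational_last_of_mem {w : W i j k} (hw : w ∈ vertexGroup i j k) :
    birational i j k F w (indet i j k F (.inl (Fin.last k))) =
      indet i j k F (.inl (Fin.last k)) := by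
  induction hw using Subgroup.closure_induction with
  | mem _ h =>
    obtain ⟨b, hb, rfl⟩ := h
    rw [birational_gen_indet]
    rcases b with ⟨_ | n, h⟩ | n | m
    · have : Fin.last k ≠ 0 := by
        rintro h0
        apply hb
        rw [h0]
        rfl
      exact act_r_zero_inl _ this
    · rw [act_r_succ_inl]
      have : n + 1 ≠ k := by
        rintro rfl
        exact hb rfl
      congr 2
      refine Equiv.swap_apply_of_ne_of_ne ?_ ?_ <;> simp [Fin.ext_iff] <;> omega
    · rfl
    · rfl
  | one => rw [map_one]; rfl
  | mul _ _ _ _ ha hb => rw [birational_mul_apply, hb, ha]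
  | inv a _ ha =>
    conv_lhs => rw [← ha]
    rw [← birational_mul_apply, inv_mul_cancel, map_one]
    rfl

/-- The rational function that gives the parameter of a vertex. -/
noncomputable def vertexFun (F : Type*) [Field F] (v : Vertex i j k) : RatField i j k F :=
  Quotient.liftOn' v (fun w => birational i j k F w (indet i j k F (.inl (Fin.last k))))
    fun a b h => by
      rw [QuotientGroup.leftRel_apply] at h
      conv_lhs => rw [← birational_last_of_mem h]
      rw [← birational_mul_apply, mul_inv_cancel_left]

theorem vertexFun_smul_base (w : W i j k) : vertexFun F (w • base i j k) =
    birational i j k F w (indet i j k F (.inl (Fin.last k))) := by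
  change birational i j k F (w * 1) _ = _
  rw [mul_one]

theorem vertexFun_smul (w : W i j k) (v : Vertex i j k) :
    vertexFun F (w • v) = birational i j k F w (vertexFun F v) := by
  obtain ⟨u, rfl⟩ := exists_smul_base v
  rw [← mul_smul, vertexFun_smul_base, vertexFun_smul_base, birational_mul_apply]

theorem hasValueAt_vertexFun_mono (v : Vertex i j k) :
    HasValueAt (vertexFun F v) (monoPoint F (1 : W i j k)) (mono F (vertexVec v)) := by
  obtain ⟨w, rfl⟩ := exists_smul_base v
  rw [vertexFun_smul_base, vertexVec_smul_base]
  have := hasValueAt_birational_monoPoint (F := F) w 1 (.inl (Fin.last k))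
  rwa [one_mul] at this

/-- Equal functions would have equal values at the monomial point, but those values are monomials of
distinct lattice vectors. It ensures that the genericity polynomials separating vertices are
non-zero. -/
theorem vertexFun_injective : Function.Injective (vertexFun F : Vertex i j k → _) := by
  intro u v h
  have hu := hasValueAt_vertexFun_mono (F := F) u
  rw [h] at hu
  exact vertexVec_injective (mono_injective F (hu.unique (hasValueAt_vertexFun_mono v)))

theorem birational_rWord (d : ℕ) (h : d ≤ k) :
    birational i j k F (rWord i j k d h) (indet i j k F (.inl (Fin.last k))) =
      indet i j k F (.inl ⟨k - d, by omega⟩) := by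
  induction d with
  | zero => rw [rWord, map_one]; rfl
  | succ d ih =>
    rw [rWord, birational_mul_apply, ih, birational_gen_indet]
    have h1 : (⟨k - d, by omega⟩ : Fin (k + 1)) = ⟨k - (d + 1) + 1, by omega⟩ := by
      rw [Fin.mk.injEq]; omega
    rw [h1, act_r_succ_inl]
    congr 2
    exact Equiv.swap_apply_right _ _

theorem birational_tWord (m : ℕ) (h : m ≤ i) (n : Fin (j + 1)) :
    birational i j k F (tWord i j k m h) (indet i j k F (.inr (0, n))) =
      indet i j k F (.inr (⟨m, by omega⟩, n)) := by
  induction m with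
  | zero => rw [tWord, map_one]; rfl
  | succ m ih =>
    rw [tWord, birational_mul_apply, ih, birational_gen_indet, act_t_inr]
    congr 3
    exact Equiv.swap_apply_left _ _

theorem birational_sWord (n : ℕ) (h : n ≤ j) (m : Fin (i + 1)) :
    birational i j k F (sWord i j k n h) (indet i j k F (.inr (m, 0))) =
      indet i j k F (.inr (m, ⟨n, by omega⟩)) := by
  induction n with
  | zero => rw [sWord, map_one]; rfl
  | succ n ih =>
    rw [sWord, birational_mul_apply, ih, birational_gen_indet, act_s_inr]
    congr 3
    exact Equiv.swap_apply_left _ _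

theorem vertexFun_vert (a : Entry i j k) : vertexFun F (vert a) = indet i j k F a := by
  rcases a with a | ⟨m, n⟩
  · rw [vert, vertexFun_smul_base, birational_rWord]
    congr 2
    ext
    change k - (k - a.val) = a.val
    omega
  · rw [vert, vertexFun_smul_base, birational_mul_apply, birational_rWord]
    have h0 : (⟨k - k, by omega⟩ : Fin (k + 1)) = 0 := by simp
    rw [h0, birational_mul_apply, birational_gen_indet, act_r_zero_inl_zero, birational_mul_apply,
      birational_tWord, birational_sWord]

end VertexFun

/-! ### Axes of facets -/

/-- The condition for the pairs `{a, a'}`, `{b, b'}`, `{c, c'}` to belong to an involution. -/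
def axisDet {K : Type*} [CommRing K] (a a' b b' c c' : K) : K :=
  (b + b' - a - a') * (c * c' - a * a') - (b * b' - a * a') * (c + c' - a - a')

/-- The determinant is, up to sign, the difference of the two sides of the cleared multi-ratio
equation. -/
theorem axisDet_multiRatioSol {K : Type*} [Field K] {y0 y0n ym0 y00 ymn : K}
    (h : multiRatioDen y0 y0n ym0 y00 ymn ≠ 0) :
    axisDet y00 ymn y0n ym0 y0 (multiRatioSol y0 y0n ym0 y00 ymn) = 0 := by
  have := (multiRatioSol_eq_iff h).mp rfl
  unfold axisDet
  linear_combination -this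

theorem map_axisDet {K K' : Type*} [CommRing K] [CommRing K'] (φ : K →+* K') (a a' b b' c c' : K) :
    φ (axisDet a a' b b' c c') = axisDet (φ a) (φ a') (φ b) (φ b') (φ c) (φ c') := by
  simp [axisDet]

/-- For `w = 1` this is the definition of the action of `r 0`. A field automorphism carries the
polynomial relation to every `w`. -/
theorem axisDet_vertexFun {F : Type*} [Field F] {m : Fin (i + 1)} {n : Fin (j + 1)} (hm : m ≠ 0)
    (hn : n ≠ 0) (w : W i j k) :
    axisDet (vertexFun F (w • vert (.inr (0, 0) : Entry i j k)))
      (vertexFun F (w • vert (.inr (m, n) : Entry i j k)))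
      (vertexFun F (w • vert (.inr (0, n) : Entry i j k)))
      (vertexFun F (w • vert (.inr (m, 0) : Entry i j k)))
      (vertexFun F (w • vert (.inl 0 : Entry i j k)))
      (vertexFun F ((w * gen (.r 0)) • vert (.inr (m, n) : Entry i j k))) = 0 := by
  have h := axisDet_multiRatioSol ((isSpecial_indet (i := i) (j := j) (k := k)
    (F := F)).actRegular m n hm hn)
  rw [← act_r_zero_inr _ hm hn, ← birational_gen_indet] at h
  rw [vertexFun_smul, vertexFun_smul, vertexFun_smul, vertexFun_smul, vertexFun_smul,
    vertexFun_smul, birational_mul_apply]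
  simp only [vertexFun_vert]
  have h' := map_axisDet (birational i j k F w : RatField i j k F →+* RatField i j k F)
    (indet i j k F (.inr (0, 0))) (indet i j k F (.inr (m, n))) (indet i j k F (.inr (0, n)))
    (indet i j k F (.inr (m, 0))) (indet i j k F (.inl 0))
    (birational i j k F (gen (.r 0)) (indet i j k F (.inr (m, n))))
  rw [h, map_zero] at h'
  exact h'.symm

theorem axisDet_value {F L : Type*} [Field F] [Field L] [Algebra F L] {y : Entry i j k → L}
    {f : Vertex i j k → RatField i j k F} {z : Vertex i j k → L}
    (h : ∀ v, HasValueAt (f v) y (z v)) {a a' b b' c c' : Vertex i j k}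
    (h0 : axisDet (f a) (f a') (f b) (f b') (f c) (f c') = 0) :
    axisDet (z a) (z a') (z b) (z b') (z c) (z c') = 0 := by
  have : HasValueAt (axisDet (f a) (f a') (f b) (f b') (f c) (f c')) y
      (axisDet (z a) (z a') (z b) (z b') (z c) (z c')) :=
    (((((h _).add (h _)).sub (h _)).sub (h _)).mul (((h _).mul (h _)).sub ((h _).mul (h _)))).sub
      ((((h _).mul (h _)).sub ((h _).mul (h _))).mul ((((h _).add (h _)).sub (h _)).sub (h _)))
  rw [h0] at this
  exact this.unique hasValueAt_zero

/-! ### Points and chords of a conic -/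

section Conic

variable {L : Type*} [Field L] {M : GL (Fin 3) L}

theorem mulVec_ne_zero (M : GL (Fin 3) L) {v : Fin 3 → L} (hv : v ≠ 0) : M.val.mulVec v ≠ 0 := by
  intro h
  have h2 : (M⁻¹).val.mulVec (M.val.mulVec v) = 0 := by rw [h, Matrix.mulVec_zero]
  rw [Matrix.mulVec_mulVec, Units.inv_mul, Matrix.one_mulVec] at h2
  exact hv h2

theorem mulVec_injective (M : GL (Fin 3) L) : Function.Injective M.val.mulVec := by
  intro v w h
  have h2 := congrArg (M⁻¹).val.mulVec h
  rwa [Matrix.mulVec_mulVec, Matrix.mulVec_mulVec, Units.inv_mul, Matrix.one_mulVec,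
    Matrix.one_mulVec] at h2

/-- The point with given homogeneous coordinates in the frame of the conic. -/
def framePoint (M : GL (Fin 3) L) (v : Fin 3 → L) (hv : v ≠ 0) : Plane L :=
  Projectivization.mk L (M.val.mulVec v) (mulVec_ne_zero M hv)

theorem exists_eq_framePoint (M : GL (Fin 3) L) (p : Plane L) :
    ∃ v, ∃ hv : v ≠ 0, p = framePoint M v hv := by
  induction p using Projectivization.ind with
  | h u hu =>
    have e : M.val.mulVec ((M⁻¹).val.mulVec u) = u := by
      rw [Matrix.mulVec_mulVec, Units.mul_inv, Matrix.one_mulVec]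
    refine ⟨(M⁻¹).val.mulVec u, mulVec_ne_zero _ hu, ?_⟩
    simp only [framePoint, e]

theorem framePoint_eq_iff {v w : Fin 3 → L} {hv : v ≠ 0} {hw : w ≠ 0} :
    framePoint M v hv = framePoint M w hw ↔ ∃ a : L, a • w = v := by
  rw [framePoint, framePoint, Projectivization.mk_eq_mk_iff']
  simp only [← Matrix.mulVec_smul, (mulVec_injective M).eq_iff]

theorem onLine_framePoint_iff {u v w : Fin 3 → L} {hu : u ≠ 0} {hv : v ≠ 0} {hw : w ≠ 0} :
    OnLine (framePoint M u hu) (framePoint M v hv) (framePoint M w hw) ↔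
      ∃ a b : L, a • v + b • w = u := by
  simp only [OnLine, framePoint, Projectivization.submodule_mk, Submodule.span_singleton_le_iff_mem,
    Submodule.mem_sup, Submodule.mem_span_singleton, exists_exists_eq_and, ← Matrix.mulVec_smul,
    ← Matrix.mulVec_add, (mulVec_injective M).eq_iff]

theorem onLine_comm {x p q : Plane L} : OnLine x p q ↔ OnLine x q p := by
  rw [OnLine, OnLine, sup_comm]

theorem conicVec_ne_zero' {a b : L} (h : a ≠ 0 ∨ b ≠ 0) : ![a ^ 2, a * b, b ^ 2] ≠ 0 := by
  intro h0
  have h1 := congrFun h0 0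
  have h2 := congrFun h0 2
  simp at h1 h2
  tauto

theorem conicPoint_eq_framePoint (x : L) : conicPoint M x =
    framePoint M ![x ^ 2, x * 1, 1 ^ 2] (conicVec_ne_zero' (.inr one_ne_zero)) := by
  simp only [conicPoint, framePoint, mul_one, one_pow]

theorem exists_eq_of_mem_conic {p : Plane L} (hp : p ∈ conic M) :
    ∃ a b, ∃ h : a ≠ 0 ∨ b ≠ 0, p = framePoint M ![a ^ 2, a * b, b ^ 2] (conicVec_ne_zero' h) := by
  obtain ⟨v, hv, h, rfl⟩ := hp
  have hv0 : v ≠ 0 := by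
    rintro rfl
    exact hv (Matrix.mulVec_zero _)
  change ∃ a b, ∃ h : a ≠ 0 ∨ b ≠ 0, framePoint M v hv0 = _
  by_cases h2 : v 2 = 0
  · have h1 : v 1 = 0 := by simpa [h2] using h.symm
    refine ⟨1, 0, .inl one_ne_zero, framePoint_eq_iff.mpr ⟨v 0, ?_⟩⟩
    ext l
    fin_cases l <;> simp [h1, h2]
  · refine ⟨v 1, v 2, .inr h2, framePoint_eq_iff.mpr ⟨(v 2)⁻¹, ?_⟩⟩
    ext l
    fin_cases l
    · simp [← h]
      field_simp
    · simp
      field_simp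
    · simp
      field_simp

theorem framePoint_conic_eq {a b a' b' : L} (h : a ≠ 0 ∨ b ≠ 0) (h' : a' ≠ 0 ∨ b' ≠ 0)
    (hab : a * b' = a' * b) :
    framePoint M ![a ^ 2, a * b, b ^ 2] (conicVec_ne_zero' h) =
      framePoint M ![a' ^ 2, a' * b', b' ^ 2] (conicVec_ne_zero' h') := by
  obtain ⟨c, rfl, rfl⟩ : ∃ c, a = c * a' ∧ b = c * b' := by
    rcases h' with h' | h'
    · exact ⟨a / a', by field_simp, by field_simp; linear_combination -hab⟩
    · exact ⟨b / b', by field_simp; linear_combination hab, by field_simp⟩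
  refine framePoint_eq_iff.mpr ⟨c ^ 2, ?_⟩
  ext l
  fin_cases l <;> simp <;> ring

/-- Three distinct points of a conic are not collinear. -/
theorem eq_or_eq_of_onLine {x p q : Plane L} (hx : x ∈ conic M) (hp : p ∈ conic M)
    (hq : q ∈ conic M) (hpq : p ≠ q) (h : OnLine x p q) : x = p ∨ x = q := by
  obtain ⟨a, b, hab, rfl⟩ := exists_eq_of_mem_conic hx
  obtain ⟨c, d, hcd, rfl⟩ := exists_eq_of_mem_conic hp
  obtain ⟨e, f, hef, rfl⟩ := exists_eq_of_mem_conic hq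
  obtain ⟨s, t, hst⟩ := onLine_framePoint_iff.mp h
  have h0 := congrFun hst 0
  have h1 := congrFun hst 1
  have h2 := congrFun hst 2
  simp at h0 h1 h2
  -- The quadratic form of the conic, evaluated at a combination of two of its points, leaves only
  -- the polar term, which is a square.
  have h3 : s * t * (c * f - e * d) ^ 2 = 0 := by
    have : (s * c ^ 2 + t * e ^ 2) * (s * d ^ 2 + t * f ^ 2) =
        (s * (c * d) + t * (e * f)) ^ 2 := by
      rw [h0, h1, h2]
      ring
    linear_combination this
  rw [mul_eq_zero, mul_eq_zero, pow_eq_zero_iff two_ne_zero, sub_eq_zero] at h3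
  rcases h3 with (rfl | rfl) | h3
  · exact .inr (framePoint_eq_iff.mpr ⟨t, by simpa using hst⟩)
  · exact .inl (framePoint_eq_iff.mpr ⟨s, by simpa using hst⟩)
  · exact absurd (framePoint_conic_eq hcd hef h3) hpq

theorem conicPoint_injective (M : GL (Fin 3) L) : Function.Injective (conicPoint M) := by
  intro x x' h
  rw [conicPoint_eq_framePoint, conicPoint_eq_framePoint, framePoint_eq_iff] at h
  obtain ⟨a, ha⟩ := h
  have h1 := congrFun ha 1
  have h2 := congrFun ha 2
  simp at h1 h2
  rw [← h1, h2, one_mul]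

/-- The linear equation of a chord. -/
theorem chord_equation {v : Fin 3 → L} {hv : v ≠ 0} {x a b : L} (h : a ≠ 0 ∨ b ≠ 0)
    (hl : OnLine (framePoint M v hv) (conicPoint M x)
      (framePoint M ![a ^ 2, a * b, b ^ 2] (conicVec_ne_zero' h))) :
    b * v 0 - (x * b + a) * v 1 + x * a * v 2 = 0 := by
  rw [conicPoint_eq_framePoint] at hl
  obtain ⟨s, t, rfl⟩ := onLine_framePoint_iff.mp hl
  simp
  ring

theorem chord_equation' {v : Fin 3 → L} {hv : v ≠ 0} {x x' : L}
    (hl : OnLine (framePoint M v hv) (conicPoint M x) (conicPoint M x')) :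
    v 0 - (x + x') * v 1 + x * x' * v 2 = 0 := by
  rw [conicPoint_eq_framePoint x'] at hl
  simpa using chord_equation (.inr one_ne_zero) hl

theorem onLine_of_chord_equation {v : Fin 3 → L} {hv : v ≠ 0} {x x' : L} (hx : x ≠ x')
    (h : v 0 - (x + x') * v 1 + x * x' * v 2 = 0) :
    OnLine (framePoint M v hv) (conicPoint M x) (conicPoint M x') := by
  have hx' := sub_ne_zero.mpr hx
  rw [conicPoint_eq_framePoint, conicPoint_eq_framePoint, onLine_framePoint_iff]
  refine ⟨(v 1 - v 2 * x') / (x - x'), (v 2 * x - v 1) / (x - x'), ?_⟩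
  ext l
  fin_cases l
  · simp
    field_simp
    linear_combination -(x - x') * h
  · simp
    field_simp
    ring
  · simp
    field_simp
    ring

/-- Two axes determine a centre. -/
theorem exists_centre (M : GL (Fin 3) L) {a a' b b' : L} (haa : a ≠ a') (hbb : b ≠ b')
    (hab : a ≠ b) (hab' : a ≠ b') :
    ∃ p : Plane L, OnLine p (conicPoint M a) (conicPoint M a') ∧
      OnLine p (conicPoint M b) (conicPoint M b') ∧
      ∀ c c', c ≠ c' → axisDet a a' b b' c c' = 0 →
        OnLine p (conicPoint M c) (conicPoint M c') := by
  -- The centre is the cross product of the coefficient vectors `(1, -(a + a'), a a')` and `(1, -(b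
  -- + b'), b b')` of the two chords. If it vanished, the pairs would have equal sums and products,
  -- making `a` equal to `b` or `b'`.
  have hv : ![a * a' * (b + b') - (a + a') * (b * b'), a * a' - b * b', a + a' - b - b'] ≠ 0 := by
    intro h0
    have h1 := congrFun h0 1
    have h2 := congrFun h0 2
    simp at h1 h2
    refine mul_ne_zero (sub_ne_zero.mpr hab) (sub_ne_zero.mpr hab') ?_
    linear_combination -h1 + a * h2
  refine ⟨framePoint M _ hv, onLine_of_chord_equation haa ?_, onLine_of_chord_equation hbb ?_,
    fun c c' hc h => onLine_of_chord_equation hc ?_⟩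
  · simp
    ring
  · simp
    ring
  · unfold axisDet at h
    simp
    linear_combination -h

/-- The end of an axis is determined by two other axes. -/
theorem eq_conicPoint_of_centre {a a' b b' c c' : L} (hab : a ≠ b) (hab' : a ≠ b') (hca : c ≠ a)
    (hca' : c ≠ a') (h : axisDet a a' b b' c c' = 0) {p x : Plane L} (hx : x ∈ conic M)
    (h1 : OnLine p (conicPoint M a) (conicPoint M a'))
    (h2 : OnLine p (conicPoint M b) (conicPoint M b')) (h3 : OnLine p (conicPoint M c) x) :
    x = conicPoint M c' := by
  obtain ⟨v, hv, rfl⟩ := exists_eq_framePoint M p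
  obtain ⟨s, t, hst, rfl⟩ := exists_eq_of_mem_conic hx
  have e1 := chord_equation' h1
  have e2 := chord_equation' h2
  have e3 := chord_equation hst h3
  -- The chord of `c, c'` lies in the pencil of the other two. The case split finds a coefficient,
  -- of sums or of products, in which those two chords differ.
  have e4 : v 0 - (c + c') * v 1 + c * c' * v 2 = 0 := by
    unfold axisDet at h
    by_cases hs : a + a' - b - b' = 0
    · have hp : a * a' - b * b' ≠ 0 := fun hp =>
        mul_ne_zero (sub_ne_zero.mpr hab) (sub_ne_zero.mpr hab')
          (by linear_combination -hp + a * hs)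
      apply mul_left_cancel₀ hp
      linear_combination (a * a' - b * b') * e1 - v 1 * h + (c * c' - a * a') * (e1 - e2)
    · apply mul_left_cancel₀ hs
      linear_combination (a + a' - b - b') * e1 - v 2 * h + (c + c' - a - a') * (e1 - e2)
  rw [conicPoint_eq_framePoint]
  apply framePoint_conic_eq hst (.inr one_ne_zero)
  -- If this vanishes, the centre is the conic point with parameter `c` and lies on the chord of `a,
  -- a'`, although `c` differs from both. Otherwise the chord equation is solvable for the ratio `s
  -- : t`.
  by_cases h5 : v 1 - c * v 2 = 0
  · exfalso
    have h6 : v 0 = c ^ 2 * v 2 := by linear_combination e4 + (c + c') * h5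
    have h7 : v 2 ≠ 0 := by
      intro h7
      apply hv
      ext l
      rw [h7] at h5 h6
      fin_cases l
      · simpa using h6
      · simpa using h5
      · simpa using h7
    apply mul_ne_zero h7 (mul_ne_zero (sub_ne_zero.mpr hca) (sub_ne_zero.mpr hca'))
    linear_combination e1 - h6 + (a + a') * h5
  · apply mul_left_cancel₀ h5
    linear_combination t * e4 - e3

end Conic

/-! ### Generic points -/

theorem node_finite (i j k : ℕ) : Finite (Node i j k) := by
  refine Finite.of_injective (β := Fin (k + 1) ⊕ Fin j ⊕ Fin i)
    (fun b => match b with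
      | .r n => .inl n
      | .s n => .inr (.inl n)
      | .t m => .inr (.inr m)) ?_
  rintro (a | a | a) (b | b | b) h <;> simp_all

theorem countable_vertex (i j k : ℕ) : Countable (Vertex i j k) := by
  have := node_finite i j k
  have : Countable (W i j k) :=
    (coxeterMatrix i j k).toCoxeterSystem.wordProd_surjective.countable
  exact QuotientGroup.mk_surjective.countable

section Generic

variable (F : Type*) [Field F]

theorem exists_num_den (v : Vertex i j k) : ∃ p q : MvPolynomial (Entry i j k) F, q ≠ 0 ∧
    vertexFun F v = algebraMap _ _ p / algebraMap _ _ q := by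
  obtain ⟨p, q, hq, h⟩ := IsFractionRing.div_surjective (A := MvPolynomial (Entry i j k) F)
    (vertexFun F v)
  exact ⟨p, q, nonZeroDivisors.ne_zero hq, h.symm⟩

/-- A numerator of the rational function of a vertex. -/
noncomputable def vertexNum (v : Vertex i j k) : MvPolynomial (Entry i j k) F :=
  (exists_num_den F v).choose

/-- A denominator of the rational function of a vertex. -/
noncomputable def vertexDen (v : Vertex i j k) : MvPolynomial (Entry i j k) F :=
  (exists_num_den F v).choose_spec.choose

theorem vertexDen_ne_zero (v : Vertex i j k) : vertexDen F v ≠ 0 :=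
  (exists_num_den F v).choose_spec.choose_spec.1

theorem vertexFun_eq_div (v : Vertex i j k) :
    vertexFun F v = algebraMap _ _ (vertexNum F v) / algebraMap _ _ (vertexDen F v) :=
  (exists_num_den F v).choose_spec.choose_spec.2

/-- The numerator of the difference of the rational functions of two vertices. -/
noncomputable def vertexDiff (u v : Vertex i j k) : MvPolynomial (Entry i j k) F :=
  vertexNum F u * vertexDen F v - vertexNum F v * vertexDen F u

theorem vertexDiff_ne_zero {u v : Vertex i j k} (h : u ≠ v) : vertexDiff F u v ≠ 0 := by
  intro h0
  refine h (vertexFun_injective (F := F) ?_)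
  rw [vertexFun_eq_div, vertexFun_eq_div,
    div_eq_div_iff (algebraMap_ratField_ne_zero (vertexDen_ne_zero F u))
      (algebraMap_ratField_ne_zero (vertexDen_ne_zero F v)), ← map_mul, ← map_mul,
    sub_eq_zero.mp h0]

variable (i j k)

/-- The polynomials that do not vanish at generic values of the entries. -/
def genericSet : Set (MvPolynomial (Entry i j k) F) :=
  Set.range (vertexDen F) ∪
    (fun p : Vertex i j k × Vertex i j k => vertexDiff F p.1 p.2) '' {p | p.1 ≠ p.2}

theorem genericSet_countable : (genericSet i j k F).Countable := by
  have := countable_vertex i j k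
  exact (Set.countable_range _).union ((Set.to_countable _).image _)

theorem genericSet_finite (h : Finite (W i j k)) : (genericSet i j k F).Finite := by
  have : Finite (Vertex i j k) := Quotient.finite _
  exact (Set.finite_range _).union ((Set.toFinite _).image _)

theorem zero_notMem_genericSet : (0 : MvPolynomial (Entry i j k) F) ∉ genericSet i j k F := by
  rintro (⟨v, hv⟩ | ⟨p, hp, h⟩)
  · exact vertexDen_ne_zero F v hv
  · exact vertexDiff_ne_zero F hp h

variable {i j k F} {L : Type*} [Field L] [Algebra F L]

/-- The parameter of a vertex. -/
noncomputable def vertexVal (F : Type*) [Field F] [Algebra F L] (y : Entry i j k → L)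
    (v : Vertex i j k) : L :=
  MvPolynomial.aeval y (vertexNum F v) / MvPolynomial.aeval y (vertexDen F v)

variable {y : Entry i j k → L}

theorem hasValueAt_vertexFun
    (hy : ∀ p ∈ genericSet i j k F, MvPolynomial.aeval y p ≠ 0)
    (v : Vertex i j k) :
    HasValueAt (vertexFun F v) y (vertexVal F y v) :=
  hasValueAt_iff_eq_div.mpr ⟨_, _, hy _ (.inl ⟨v, rfl⟩), vertexFun_eq_div F v, rfl⟩

theorem vertexVal_vert
    (hy : ∀ p ∈ genericSet i j k F, MvPolynomial.aeval y p ≠ 0)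
    (a : Entry i j k) : vertexVal F y (vert a) = y a := by
  have := hasValueAt_vertexFun hy (vert a)
  rw [vertexFun_vert] at this
  exact this.unique (hasValueAt_indet a)

theorem vertexVal_injective
    (hy : ∀ p ∈ genericSet i j k F, MvPolynomial.aeval y p ≠ 0)
    : Function.Injective (vertexVal F y : Vertex i j k → L) := by
  intro u v h
  by_contra hne
  refine hy _ (.inr ⟨(u, v), hne, rfl⟩) ?_
  unfold vertexVal at h
  rw [div_eq_div_iff (hy _ (.inl ⟨u, rfl⟩)) (hy _ (.inl ⟨v, rfl⟩))] at h
  simp only [vertexDiff, map_sub, map_mul]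
  rw [h, sub_self]

/-! ### The inscribed figure -/

theorem isInscribed_vertexVal
    (hy : ∀ p ∈ genericSet i j k F, MvPolynomial.aeval y p ≠ 0)
    (M : GL (Fin 3) L) :
    IsInscribed M fun v : Vertex i j k => conicPoint M (vertexVal F y v) := by
  have hinj : Function.Injective fun v : Vertex i j k => conicPoint M (vertexVal F y v) :=
    (conicPoint_injective M).comp (vertexVal_injective hy)
  refine ⟨fun v => conicPoint_mem_conic M _, hinj, fun u v x huv => ⟨fun h => ?_, ?_⟩⟩
  · have hne : u ≠ v := by
      rintro rfl
      have := huv.latForm_sub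
      simp at this
    exact (eq_or_eq_of_onLine (conicPoint_mem_conic M _) (conicPoint_mem_conic M _)
      (conicPoint_mem_conic M _) (hinj.ne hne) h).imp (fun h => hinj h) (fun h => hinj h)
  · rintro (rfl | rfl)
    · exact le_sup_left
    · exact le_sup_right

theorem axisDet_vertexVal
    (hy : ∀ p ∈ genericSet i j k F, MvPolynomial.aeval y p ≠ 0)
    {m : Fin (i + 1)} {n : Fin (j + 1)} (hm : m ≠ 0) (hn : n ≠ 0)
    (w : W i j k) :
    axisDet (vertexVal F y (w • vert (.inr (0, 0)))) (vertexVal F y (w • vert (.inr (m, n))))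
      (vertexVal F y (w • vert (.inr (0, n)))) (vertexVal F y (w • vert (.inr (m, 0))))
      (vertexVal F y (w • vert (.inl 0)))
      (vertexVal F y ((w * gen (.r 0)) • vert (.inr (m, n)))) = 0 :=
  axisDet_value (hasValueAt_vertexFun hy) (axisDet_vertexFun hm hn w)

theorem vertexVal_smul_vert_ne
    (hy : ∀ p ∈ genericSet i j k F, MvPolynomial.aeval y p ≠ 0)
    (w : W i j k) {a b : Entry i j k} (h : a ≠ b) :
    vertexVal F y (w • vert a) ≠ vertexVal F y (w • vert b) :=
  (vertexVal_injective hy).ne (by rwa [ne_eq, smul_left_cancel_iff, vert_injective.eq_iff])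

/-- The centre is taken as the intersection of the two axes inside the moved second array. Every
other axis is the third one for some `w'` that agrees with `w` on that array, so it passes through
the same point. -/
theorem hasCentres_vertexVal
    (hy : ∀ p ∈ genericSet i j k F, MvPolynomial.aeval y p ≠ 0)
    (hi : 1 ≤ i) (hj : 1 ≤ j) (M : GL (Fin 3) L) :
    HasCentres fun v : Vertex i j k => conicPoint M (vertexVal F y v) := by
  intro w
  obtain ⟨m, hm⟩ : ∃ m : Fin (i + 1), m.val = 1 := ⟨⟨1, by omega⟩, rfl⟩
  obtain ⟨n, hn⟩ : ∃ n : Fin (j + 1), n.val = 1 := ⟨⟨1, by omega⟩, rfl⟩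
  have hm0 : m ≠ 0 := fun h => by simp [h] at hm
  have hn0 : n ≠ 0 := fun h => by simp [h] at hn
  obtain ⟨c, h1, h2, h3⟩ := exists_centre M
    (vertexVal_smul_vert_ne hy w (a := .inr (0, 0)) (b := .inr (m, n)) (by simp [hm0.symm]))
    (vertexVal_smul_vert_ne hy w (a := .inr (0, n)) (b := .inr (m, 0)) (by simp [hm0.symm]))
    (vertexVal_smul_vert_ne hy w (by simp [hn0.symm]))
    (vertexVal_smul_vert_ne hy w (by simp [hm0.symm]))
  refine ⟨c, fun u v huv => ?_⟩
  have hne : vertexVal F y u ≠ vertexVal F y v := (vertexVal_injective hy).ne huv.2.2.1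
  obtain ⟨w', hw', h⟩ := huv.cases hm hn
  have h4 := axisDet_vertexVal hy hm0 hn0 w'
  simp only [hw'] at h h4
  rcases h with ⟨rfl, rfl⟩ | ⟨rfl, rfl⟩ | ⟨rfl, rfl⟩ | ⟨rfl, rfl⟩ | ⟨rfl, rfl⟩ | ⟨rfl, rfl⟩
  · exact h1
  · exact onLine_comm.mp h1
  · exact h2
  · exact onLine_comm.mp h2
  · exact h3 _ _ hne h4
  · exact onLine_comm.mp (h3 _ _ hne.symm h4)

/-- Induction on words, appending generators on the right, so that the whole moved compound simplex
is known at each stage. A generator permutes its vertices except for `y_mn` under `r 0`; that vertex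
is the far end of an axis whose near end and two companion axes are already placed. -/
theorem eq_vertexVal_of_hasCentres
    (hy : ∀ p ∈ genericSet i j k F, MvPolynomial.aeval y p ≠ 0)
    (hi : 1 ≤ i) (hj : 1 ≤ j) {M : GL (Fin 3) L}
    {ψ : Vertex i j k → Plane L} (hψ : IsInscribed M ψ) (hc : HasCentres ψ)
    (h : ∀ a, ψ (vert a) = conicPoint M (y a)) (v : Vertex i j k) :
    ψ v = conicPoint M (vertexVal F y v) := by
  obtain ⟨m₁, hm₁⟩ : ∃ m : Fin (i + 1), m.val = 1 := ⟨⟨1, by omega⟩, rfl⟩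
  obtain ⟨n₁, hn₁⟩ : ∃ n : Fin (j + 1), n.val = 1 := ⟨⟨1, by omega⟩, rfl⟩
  have hm₁0 : m₁ ≠ 0 := fun h => by simp [h] at hm₁
  have hn₁0 : n₁ ≠ 0 := fun h => by simp [h] at hn₁
  suffices hw : ∀ (w : W i j k) (a : Entry i j k),
      ψ (w • vert a) = conicPoint M (vertexVal F y (w • vert a)) by
    obtain ⟨w, rfl⟩ := exists_smul_base v
    rw [← vert_last]
    exact hw w _
  intro w
  induction w using (coxeterMatrix i j k).toCoxeterSystem.simple_induction_right with
  | one =>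
    intro a
    rw [one_smul, h, vertexVal_vert hy]
  | mul_simple_right w g ih =>
    rw [CoxeterMatrix.toCoxeterSystem_simple]
    change ∀ a, ψ ((w * gen g : W i j k) • vert a) =
      conicPoint M (vertexVal F y ((w * gen g : W i j k) • vert a))
    have key : ∀ {a b : Entry i j k}, latRep i j k (gen g) (latVec a) = latVec b →
        ψ ((w * gen g : W i j k) • vert a) =
          conicPoint M (vertexVal F y ((w * gen g : W i j k) • vert a)) := fun {a b} hab => by
      rw [mul_smul, smul_vert_eq_vert_iff.mpr hab, ih]
    intro a
    rcases g with ⟨_ | n, hn⟩ | n | m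
    · induction a using entry_cases with
      | hl0 => exact key latRep_r_zero_inl_zero
      | hl a ha => exact key (latRep_r_zero_inl ha)
      | h00 => exact key latRep_r_zero_inr_zero
      | hm0 m hm => exact key (latRep_r_zero_inr (by simp [hm]) (.inr rfl))
      | h0n n hn => exact key (latRep_r_zero_inr (by simp [hn]) (.inl rfl))
      | hmn m n hm hn =>
        -- Facets are translates of the one with indices `0, 1`. Permuting rows and columns carries
        -- it to the facet through `y_00`, `y_m0`, `y_0n` and `y_mn`.
        obtain ⟨σ, σ0, σ1⟩ := exists_perm_map hm₁0.symm hm.symm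
        obtain ⟨τ, τ0, τ1⟩ := exists_perm_map hn₁0.symm hn.symm
        obtain ⟨x, hx, hx'⟩ := exists_smul_vert (1 : Equiv.Perm (Fin (k + 1))) σ τ
        have x0 : ∀ a, x • vert (.inl a) = (vert (.inl a) : Vertex i j k) := hx
        have x1 : x • vert (.inr (m₁, n₁)) = (vert (.inr (m, n)) : Vertex i j k) := by
          rw [hx', σ1, τ1]
        have x2 : x • vert (.inr (0, 0)) = (vert (.inr (0, 0)) : Vertex i j k) := by
          rw [hx', σ0, τ0]
        have x3 : x • vert (.inr (0, n₁)) = (vert (.inr (0, n)) : Vertex i j k) := by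
          rw [hx', σ0, τ1]
        have x4 : x • vert (.inr (m₁, 0)) = (vert (.inr (m, 0)) : Vertex i j k) := by
          rw [hx', σ1, τ0]
        -- The permutation need not commute with `r 0` in the group; the two vertices are compared
        -- through their lattice vectors.
        have x5 : x • (gen (.r 0) : W i j k) • vert (.inr (m₁, n₁)) =
            (gen (.r 0) : W i j k) • (vert (.inr (m, n)) : Vertex i j k) := by
          apply vertexVec_injective
          rw [vertexVec_smul, vertexVec_smul, vertexVec_smul, vertexVec_vert, vertexVec_vert,
            latRep_r_zero_inr_of_ne hm₁0 hn₁0, latRep_r_zero_inr_of_ne hm hn, map_sub, map_add,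
            smul_vert_eq_vert_iff.mp x4, smul_vert_eq_vert_iff.mp x3,
            smul_vert_eq_vert_iff.mp (x0 0)]
        obtain ⟨o1, o2, o3⟩ := opposing_one (k := k) hm₁ hn₁
        have o1' := o1.smul (w * x)
        have o2' := o2.smul (w * x)
        have o3' := o3.smul (w * x)
        rw [mul_smul, mul_smul, x1, x2, mul_one] at o1'
        rw [mul_smul, mul_smul, x3, x4, mul_one] at o2'
        rw [mul_smul, mul_smul, x5, x0, mul_one] at o3'
        obtain ⟨c, hc⟩ := hc (w * x)
        have c1 := hc _ _ o1'
        have c2 := hc _ _ o2'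
        have c3 := hc _ _ o3'
        rw [ih, ih] at c1 c2
        rw [ih, ← mul_smul] at c3
        exact eq_conicPoint_of_centre (vertexVal_smul_vert_ne hy w (by simp [hn.symm]))
          (vertexVal_smul_vert_ne hy w (by simp [hm.symm]))
          (vertexVal_smul_vert_ne hy w (by simp)) (vertexVal_smul_vert_ne hy w (by simp))
          (axisDet_vertexVal hy hm hn w) (hψ.mem_conic _) c1 c2 c3
    · rcases a with a | p
      · exact key (latRep_r_succ_inl _ _ _)
      · exact key (latRep_r_succ_inr _ _ _)
    · rcases a with a | p
      · exact key (latRep_s_inl _ _)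
      · exact key (latRep_s_inr _ _)
    · rcases a with a | p
      · exact key (latRep_t_inl _ _)
      · exact key (latRep_t_inr _ _)

end Generic

end GossetElte

open GossetElte in
theorem proposition4p1 (i j k : ℕ) (hi : 1 ≤ i) (hj : 1 ≤ j) (F : Type*) [Field F] :
    -- the compound simplex is a sub-figure of the `k_{i,j}`-figure
    (Function.Injective (vert : Entry i j k → Vertex i j k) ∧
      ∀ a b : Entry i j k, Adj (vert a) (vert b) ↔ SimplexAdj a b) ∧
    -- the birational actions generate a representation of the Coxeter group
    ∃ ρ : W i j k →* (RatField i j k F ≃ₐ[F] RatField i j k F),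
      (∀ (g : Node i j k) (a : Entry i j k),
        ρ (gen g) (indet i j k F a) = act g (indet i j k F) a) ∧
      -- generic: outside countably (finitely, for a finite group) many proper hypersurfaces
      ∃ P : Set (MvPolynomial (Entry i j k) F),
        P.Countable ∧ (Finite (W i j k) → P.Finite) ∧ (0 : MvPolynomial (Entry i j k) F) ∉ P ∧
        ∀ (L : Type*) [Field L] [Algebra F L] (y : Entry i j k → L),
          (∀ p ∈ P, MvPolynomial.aeval y p ≠ 0) →
          ∀ M : GL (Fin 3) L,
            ∃ φ : Vertex i j k → Plane L,
              -- the figure exists, and it is determined by the sub-figure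
              (IsInscribed M φ ∧ HasCentres φ ∧ ∀ a, φ (vert a) = conicPoint M (y a)) ∧
              (∀ ψ : Vertex i j k → Plane L,
                IsInscribed M ψ → HasCentres ψ → (∀ a, ψ (vert a) = conicPoint M (y a)) →
                ψ = φ) ∧
              -- the actions give the image of the sub-figure under the symmetries of the figure
              ∀ (w : W i j k) (a : Entry i j k), ∃ z : L,
                HasValueAt (ρ w (indet i j k F a)) y z ∧ φ (w • vert a) = conicPoint M z := by
  refine ⟨⟨vert_injective, adj_vert_iff⟩, birational i j k F, birational_gen_indet,
    genericSet i j k F, genericSet_countable i j k F, genericSet_finite i j k F,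
    zero_notMem_genericSet i j k F, fun L _ _ y hy M =>
    ⟨fun v => conicPoint M (vertexVal F y v), ⟨isInscribed_vertexVal hy M,
      hasCentres_vertexVal hy hi hj M, fun a => by simp only [vertexVal_vert hy]⟩,
      fun ψ hψ hc h => funext (eq_vertexVal_of_hasCentres hy hi hj hψ hc h), fun w a =>
      ⟨vertexVal F y (w • vert a), ?_, rfl⟩⟩⟩
  -- By equivariance `ρ(w)(y_e)` is the rational function of the vertex `w V(e)`, whose value is the
  -- parameter used to define the figure.
  rw [← vertexFun_vert, ← vertexFun_smul]
  exact hasValueAt_vertexFun hy _
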